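/- \textbf{Setting.} Let $K,T\ge 1$ be integers. At each step $t=1,\dots,T$ a learner plays an arm $a_t\in[K]=\{1,\dots,K\}$ and then observes only the loss $\ell_{t,a_t}$, where $\ell_t=(\ell_{t,1},\dots,\ell_{t,K})\in[0,1]^K$ is a random vector that is independent of everything that happened before step $t$ (the previous loss vectors, the previous arms and any internal randomness used to break ties up to and including step $t$). Let $\mu_t=\mathbb{E}[\ell_t]$, $\mu_0=0$, and $$V=\sum_{t=1}^T\|\mu_t-\mu_{t-1}\|_\infty,\qquad \Lambda=\sum_{t=1}^T\mathbb{E}\big[\|\ell_t-\mu_t\|_2^2\big].$$ The expected dynamic pseudo-regret of the learner is $$R_T=\mathbb{E}\Big[\sum_{t=1}^T\big(\mu_{t,a_t}-\min_{i\in[K]}\mu_{t,i}\big)\Big].$$ \textbf{The algorithm Rerun-UCB-V} (which knows $K,T,V,\Lambda$). Put $\delta=1/(KT)$ and $$B=\Big\lceil\big(K^2\Lambda T/V^2\big)^{1/3}\Big\rceil\ \text{ if } K\Lambda^2\ge TV,\qquad B=\Big\lceil\sqrt{KT/V}\Big\rceil\ \text{ otherwise}$$ (if $V=0$, put $B=T$).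 Divide $1,\dots,T$ into consecutive blocks of $B$ steps (the last block may be shorter). For a step $t$ in a block $\mathcal{I}$ and an arm $i$, let $S_{t,i}$ be the set of steps before $t$ in $\mathcal{I}$ at which arm $i$ was played, let $n=|S_{t,i}|$, and let $$\hat\mu_{t,i}=\frac1n\sum_{s\in S_{t,i}}\ell_{s,i},\qquad \hat\Lambda_{t,i}=\sum_{r\in S_{t,i}}\sum_{s\in S_{t,i}}\frac{(\ell_{r,i}-\ell_{s,i})^2}{n(n-1)},\qquad \lambda_{t,i}=\sqrt{\frac{2\hat\Lambda_{t,i}\log(2/\delta)}{n}}+\frac{7\log(2/\delta)}{3(n-1)},$$ with the conventions $\hat\mu_{t,i}=0$ if $n=0$, and $\hat\Lambda_{t,i}=0$, $\lambda_{t,i}=1$ if $n\le 1$. At step $t$ the algorithm plays an arm $a_t$ that minimizes $\hat\mu_{t,i}-\lambda_{t,i}$ over $i\in[K]$; ties are broken in an arbitrary way that does not look at the losses of step $t$ or later. \textbf{Theorem.} There are absolute constants $C>0$ and $p\in\mathbb{N}$ such that for all $K,T\ge1$ and all loss distributions as above, every run of Rerun-UCB-V satisfies $$R_T\le C\,\big(1+\log(KT)\big)^p\Big(\sqrt[3]{K^2\Lambda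 VT}+\sqrt{KVT}\Big).$$ -/

import Mathlib

open MeasureTheory ProbabilityTheory

noncomputable section

namespace RerunUCBV

/-! ### The algorithm

Time steps are `0, …, T - 1` and arms are the elements of `Fin K`. In this section `x s i` is the
loss of arm `i` at step `s` and `a s` is the arm played at step `s`, along one sample path. -/

variable {K : ℕ}

/-- The steps before `t`, in the same block of length `B` as `t`, at which arm `i` was played. -/
def plays (B : ℕ) (a : ℕ → Fin K) (t : ℕ) (i : Fin K) : Finset ℕ :=
  (Finset.range t).filter (fun s => s / B = t / B ∧ a s = i)

/-- Empirical mean of the losses of arm `i` over the steps in `S` (it is `0` if `S` is empty). -/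
def empMean (x : ℕ → Fin K → ℝ) (S : Finset ℕ) (i : Fin K) : ℝ :=
  if S.card = 0 then 0 else (∑ s ∈ S, x s i) / (S.card : ℝ)

/-- Empirical variance of the losses of arm `i` over the steps in `S`; the sum runs over all ordered
pairs `(r, s)`. -/
def empVar (x : ℕ → Fin K → ℝ) (S : Finset ℕ) (i : Fin K) : ℝ :=
  if S.card ≤ 1 then 0
  else ∑ r ∈ S, ∑ s ∈ S, (x r i - x s i) ^ 2 / ((S.card : ℝ) * ((S.card : ℝ) - 1))

/-- The empirical Bernstein radius `ρ(n, W, δ)`, used for `2 ≤ n`. -/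
def rho (n : ℕ) (W δ : ℝ) : ℝ :=
  Real.sqrt (2 * W * Real.log (2 / δ) / (n : ℝ)) +
    7 * Real.log (2 / δ) / (3 * ((n : ℝ) - 1))

/-- Size of the confidence interval of arm `i`. -/
def radius (δ : ℝ) (x : ℕ → Fin K → ℝ) (S : Finset ℕ) (i : Fin K) : ℝ :=
  if S.card ≤ 1 then 1 else rho S.card (empVar x S i) δ

/-- The optimistic index (empirical mean minus size of the confidence interval) of arm `i` just
before step `t`, when the statistics are cleared every `B` steps. -/
def index (B : ℕ) (δ : ℝ) (x : ℕ → Fin K → ℝ) (a : ℕ → Fin K) (t : ℕ) (i : Fin K) : ℝ :=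
  empMean x (plays B a t i) i - radius δ x (plays B a t i) i

/-- Block length chosen from `K`, `T`, the total drift `V` and the total variance `Λ`, rounded up.
If `V = 0` the whole horizon is one block. -/
def blockLength (K T : ℕ) (V Λ : ℝ) : ℕ :=
  if V = 0 then T
  else if (T : ℝ) * V ≤ (K : ℝ) * Λ ^ 2 then
    ⌈((K : ℝ) ^ 2 * Λ * (T : ℝ) / V ^ 2) ^ ((1 : ℝ) / 3)⌉₊
  else ⌈Real.sqrt ((K : ℝ) * (T : ℝ) / V)⌉₊

/-- `a` is a run of Rerun-UCB-V over `T` steps on the loss sequence `x`, with parameters `V`, `Λ`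
and `δ = 1 / (K T)`: every step plays an arm of least index (ties are broken in any way). -/
def IsRun (T : ℕ) (V Λ : ℝ) (x : ℕ → Fin K → ℝ) (a : ℕ → Fin K) : Prop :=
  ∀ t < T, ∀ i : Fin K,
    index (blockLength K T V Λ) (1 / ((K : ℝ) * (T : ℝ))) x a t (a t) ≤
      index (blockLength K T V Λ) (1 / ((K : ℝ) * (T : ℝ))) x a t i

/-! ### The environment

Now `ℓ t ω i` is the random loss of arm `i` at step `t`. -/

variable {Ω : Type*} [MeasurableSpace Ω]

/-- The mean loss vector of step `t`. -/
def mean (P : Measure Ω) (ℓ : ℕ → Ω → Fin K → ℝ) (t : ℕ) : Fin K → ℝ :=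
  fun i => ∫ ω, ℓ t ω i ∂P

/-- The mean loss vector of the step preceding `t`, which is the zero vector for the first step. -/
def prevMean (P : Measure Ω) (ℓ : ℕ → Ω → Fin K → ℝ) : ℕ → Fin K → ℝ
  | 0 => 0
  | t + 1 => mean P ℓ t

/-- The total drift; the norm of `Fin K → ℝ` is the supremum norm. -/
def totalDrift (P : Measure Ω) (ℓ : ℕ → Ω → Fin K → ℝ) (T : ℕ) : ℝ :=
  ∑ t ∈ Finset.range T, ‖mean P ℓ t - prevMean P ℓ t‖

/-- The total variance: the sum over the steps of the expected squared Euclidean distance of the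
loss vector to its mean. -/
def totalVariance (P : Measure Ω) (ℓ : ℕ → Ω → Fin K → ℝ) (T : ℕ) : ℝ :=
  ∑ t ∈ Finset.range T, ∫ ω, ∑ i : Fin K, (ℓ t ω i - mean P ℓ t i) ^ 2 ∂P

/-- The expected dynamic pseudo-regret of the (random) sequence of arms `a`. -/
def expectedRegret (P : Measure Ω) (ℓ : ℕ → Ω → Fin K → ℝ) (T : ℕ) (a : ℕ → Ω → Fin K) : ℝ :=
  ∫ ω, ∑ t ∈ Finset.range T, (mean P ℓ t (a t ω) - ⨅ i : Fin K, mean P ℓ t i) ∂P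

end RerunUCBV

end

/-!
The learner is optimistic, so in a block where all confidence intervals hold, each step costs at
most twice the drift of the block plus twice the radius of the played arm. The proof controls the
probability that an interval fails, the sum of the radii, and the choice of the block length.

*Confidence.* For `g > 0` and `θ = 1 / (1 + g)`, the inequality
`exp (θ ξ - θ² / (2 (1 - θ)) ξ²) ≤ 1 + θ ξ` (`exp_sub_sq_le_one_add`) is applied to the deviation
`ξ`, taken with either sign, of a loss from the mean `c_s` of the earlier losses of its arm in the
block. It makes `exp (∑ (θ (x_s - μ_s) - θ² / (2 (1 - θ)) (x_s - c_s)²))` a supermartingale,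
whatever the drift of the means and of the variances. Ville's inequality
(`measureReal_exists_le_le`) bounds the probability that it ever reaches `exp L` by `exp (-L)`,
uniformly over the steps of the block. The compensator is observable, and Welford's recursion
bounds it by the empirical sum of squares `Q` (`sum_sub_runningMean_sq_le`). Optimizing over the
dyadic grid `g = 2 ^ j` gives `|∑ (x_s - μ_s)| ≤ 2 √(L Q) + 7 L / 3` (`deviation_le_of_grid`), and
after `n ≥ 2` plays the right side is at most `n` times the radius of the algorithm: the empirical
variance there sums over ordered pairs, hence is twice the sample variance, and this factor pays for
the grid and for the running mean. With `L = log (2 K T)` a union over arms, signs and the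
`O(log T)` grid points shows that a block fails with probability `O(log T / T)`, so the failures
cost `O(log T)` in total.

*Radii.* Over the plays of one arm in one block, the radii sum to at most
`2 + (1 + L) (2 √(L Q) + 7 L / 3)` (`sum_radius_le`). Summing over the `N` blocks and the arms with
the Cauchy–Schwarz inequality, bounding each `Q` by the squared deviations from the means at the
start of the block, and using Jensen's inequality for the square root, gives an expected total of
order `K N + √(K N (Λ + B V))` up to logarithms (`IsEnvironment.expectedRegret_le`).

*Tuning.* Let `x` be the block length before rounding and `g = x V`. In both regimes `g` is at most
the target, `K T ≤ x g` and `K Λ T ≤ x g²` (`exists_blockLength_eq`), so that all terms above are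
`O(g)` up to logarithms when `x < T`; in that case also `1 ≤ K < g`, which absorbs the cost of the
failures. When `x ≥ T`, the means, which start from `0`, never exceed `V`, and the regret is at most
`T V ≤ x V = g`.
-/

namespace RerunUCBV

/-! ### Empirical means and sums of squares -/

/-- The sum of squared deviations of a family from its empirical mean. -/
noncomputable def sumSqDev (f : ℕ → ℝ) (S : Finset ℕ) : ℝ :=
  ∑ s ∈ S, (f s - (∑ r ∈ S, f r) / S.card) ^ 2

lemma sumSqDev_nonneg (f : ℕ → ℝ) (S : Finset ℕ) : 0 ≤ sumSqDev f S :=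
  Finset.sum_nonneg fun _ _ => sq_nonneg _

lemma sum_sub_const_sq_eq (f : ℕ → ℝ) (S : Finset ℕ) (c : ℝ) :
    ∑ s ∈ S, (f s - c) ^ 2 = ∑ s ∈ S, f s ^ 2 - 2 * c * ∑ s ∈ S, f s + S.card * c ^ 2 := by
  simp only [sub_sq, Finset.sum_add_distrib, Finset.sum_sub_distrib, Finset.sum_const,
    nsmul_eq_mul, Finset.mul_sum]
  congr 2
  exact Finset.sum_congr rfl fun _ _ => by ring

lemma sumSqDev_eq (f : ℕ → ℝ) (S : Finset ℕ) :
    sumSqDev f S = ∑ s ∈ S, f s ^ 2 - (∑ s ∈ S, f s) ^ 2 / S.card := by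
  rcases S.eq_empty_or_nonempty with rfl | h
  · simp [sumSqDev]
  · have : (S.card : ℝ) ≠ 0 := by exact_mod_cast h.card_pos.ne'
    rw [sumSqDev, sum_sub_const_sq_eq]
    field_simp
    ring

lemma sumSqDev_le (f : ℕ → ℝ) (S : Finset ℕ) (c : ℝ) :
    sumSqDev f S ≤ ∑ s ∈ S, (f s - c) ^ 2 := by
  rcases S.eq_empty_or_nonempty with rfl | h
  · simp [sumSqDev]
  · have h0 : (0 : ℝ) < S.card := by exact_mod_cast h.card_pos
    rw [sumSqDev_eq, sum_sub_const_sq_eq]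
    have : 0 ≤ S.card * (c - (∑ s ∈ S, f s) / S.card) ^ 2 := by positivity
    have e : S.card * (c - (∑ s ∈ S, f s) / S.card) ^ 2
        = S.card * c ^ 2 - 2 * c * ∑ s ∈ S, f s + (∑ s ∈ S, f s) ^ 2 / S.card := by
      field_simp
      ring
    linarith

/-- Welford's update of the sum of squared deviations. -/
lemma sumSqDev_insert (f : ℕ → ℝ) {S : Finset ℕ} {t : ℕ} (ht : t ∉ S) :
    sumSqDev f (insert t S) = sumSqDev f S
      + S.card / (S.card + 1) * (f t - (∑ r ∈ S, f r) / S.card) ^ 2 := by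
  rw [sumSqDev_eq, sumSqDev_eq, Finset.sum_insert ht, Finset.sum_insert ht,
    Finset.card_insert_of_notMem ht]
  rcases S.eq_empty_or_nonempty with rfl | h
  · simp
  · have h0 : (0 : ℝ) < S.card := by exact_mod_cast h.card_pos
    have h1 : (0 : ℝ) < S.card + 1 := by positivity
    push_cast
    field_simp
    ring

lemma sum_sum_sub_sq (f : ℕ → ℝ) {S : Finset ℕ} (h : S.Nonempty) :
    ∑ r ∈ S, ∑ s ∈ S, (f r - f s) ^ 2 = 2 * S.card * sumSqDev f S := by
  have h0 : (0 : ℝ) < S.card := by exact_mod_cast h.card_pos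
  have (r : ℕ) : ∑ s ∈ S, (f r - f s) ^ 2
      = ∑ s ∈ S, f s ^ 2 - 2 * (∑ s ∈ S, f s) * f r + S.card * f r ^ 2 := by
    rw [Finset.sum_congr rfl fun s _ => sub_sq_comm (f r) (f s), sum_sub_const_sq_eq]
    ring
  rw [Finset.sum_congr rfl fun r _ => this r, Finset.sum_add_distrib, Finset.sum_sub_distrib,
    ← Finset.mul_sum, ← Finset.mul_sum, sumSqDev_eq]
  simp only [Finset.sum_const, nsmul_eq_mul]
  field_simp
  ring

variable {K : ℕ}

lemma empMean_eq (x : ℕ → Fin K → ℝ) (S : Finset ℕ) (i : Fin K) :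
    empMean x S i = (∑ s ∈ S, x s i) / S.card := by
  unfold empMean
  split_ifs with h <;> simp [h]

lemma empMean_mem_Icc {x : ℕ → Fin K → ℝ} {S : Finset ℕ} {i : Fin K}
    (hx : ∀ s ∈ S, x s i ∈ Set.Icc (0 : ℝ) 1) : empMean x S i ∈ Set.Icc (0 : ℝ) 1 := by
  rw [empMean_eq]
  refine ⟨div_nonneg (Finset.sum_nonneg fun s hs => (hx s hs).1) (by positivity), ?_⟩
  refine div_le_one_of_le₀ ?_ (by positivity)
  simpa using Finset.sum_le_sum fun s hs => (hx s hs).2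

/-- The empirical variance of the algorithm is twice the unbiased sample variance, because its
sum runs over ordered pairs. -/
lemma empVar_eq (x : ℕ → Fin K → ℝ) {S : Finset ℕ} (i : Fin K) (h : 2 ≤ S.card) :
    empVar x S i = 2 * sumSqDev (fun s => x s i) S / (S.card - 1) := by
  have h2 : (2 : ℝ) ≤ S.card := by exact_mod_cast h
  have h1 : (S.card : ℝ) - 1 ≠ 0 := by linarith
  have h0 : (S.card : ℝ) ≠ 0 := by linarith
  rw [empVar, if_neg (by omega)]
  simp only [← Finset.sum_div]
  rw [sum_sum_sub_sq (fun s => x s i) (Finset.card_pos.1 (by omega))]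
  field_simp

lemma radius_eq {x : ℕ → Fin K → ℝ} {S : Finset ℕ} {i : Fin K} {δ : ℝ} (h : 2 ≤ S.card) :
    radius δ x S i =
      √(4 * sumSqDev (fun s => x s i) S * Real.log (2 / δ) / (S.card * (S.card - 1)))
        + 7 * Real.log (2 / δ) / (3 * (S.card - 1)) := by
  have h2 : (2 : ℝ) ≤ S.card := by exact_mod_cast h
  have h1 : (S.card : ℝ) - 1 ≠ 0 := by linarith
  have h0 : (S.card : ℝ) ≠ 0 := by linarith
  rw [radius, if_neg (by omega), rho, empVar_eq x i h]
  congr 2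
  field_simp
  ring

lemma le_card_mul_radius {x : ℕ → Fin K → ℝ} {S : Finset ℕ} {i : Fin K} {δ L : ℝ}
    (h : 2 ≤ S.card) (hL : L = Real.log (2 / δ)) (hL0 : 0 ≤ L) :
    2 * √(L * sumSqDev (fun s => x s i) S) + 7 / 3 * L ≤ S.card * radius δ x S i := by
  have h2 : (2 : ℝ) ≤ S.card := by exact_mod_cast h
  have hQ := sumSqDev_nonneg (fun s => x s i) S
  rw [radius_eq h, ← hL]
  set Q := sumSqDev (fun s => x s i) S
  set n : ℝ := (S.card : ℝ)
  have h1 : 0 < n - 1 := by linarith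
  rw [mul_add]
  refine add_le_add ?_ ?_
  · rw [show (2 : ℝ) = √4 by rw [show (4 : ℝ) = 2 ^ 2 by norm_num]; simp,
      ← Real.sqrt_mul (by norm_num)]
    have e (z : ℝ) : n * √z = √(n ^ 2 * z) := by
      rw [Real.sqrt_mul (by positivity), Real.sqrt_sq (by linarith)]
    rw [e]
    refine Real.sqrt_le_sqrt ?_
    rw [mul_div_assoc', le_div_iff₀ (by positivity)]
    have : 0 ≤ L * Q * n := by positivity
    nlinarith
  · rw [mul_div_assoc', le_div_iff₀ (by positivity)]
    nlinarith

lemma radius_le {x : ℕ → Fin K → ℝ} {S : Finset ℕ} {i : Fin K} {δ L Q : ℝ}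
    (h : 2 ≤ S.card) (hL : L = Real.log (2 / δ)) (hL0 : 0 ≤ L)
    (hQ : sumSqDev (fun s => x s i) S ≤ Q) :
    radius δ x S i ≤ (2 * √(L * Q) + 7 / 3 * L) * ((S.card : ℝ) - 1)⁻¹ := by
  have h2 : (2 : ℝ) ≤ S.card := by exact_mod_cast h
  have hQ0 := sumSqDev_nonneg (fun s => x s i) S
  have hQ1 : 0 ≤ Q := hQ0.trans hQ
  rw [radius_eq h, ← hL]
  set q := sumSqDev (fun s => x s i) S
  set n : ℝ := (S.card : ℝ)
  have h1 : 0 < n - 1 := by linarith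
  rw [add_mul]
  refine add_le_add ?_ (le_of_eq (by field_simp))
  have : 4 * q * L / (n * (n - 1)) ≤ 4 * (L * Q) / (n - 1) ^ 2 := by
    refine div_le_div₀ (by positivity) (by nlinarith) (by positivity) (by nlinarith)
  refine (Real.sqrt_le_sqrt this).trans (le_of_eq ?_)
  rw [Real.sqrt_div' _ (by positivity), Real.sqrt_sq h1.le, Real.sqrt_mul (by norm_num),
    show √(4 : ℝ) = 2 by rw [show (4 : ℝ) = 2 ^ 2 by norm_num]; simp, div_eq_mul_inv]

/-! ### The plays of one arm in one block -/

/-- The steps before `t` in block number `k`, for blocks of length `B`, at which `i` is played. -/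
def blockPlays (B : ℕ) (a : ℕ → Fin K) (k t : ℕ) (i : Fin K) : Finset ℕ :=
  (Finset.range t).filter (fun s => s / B = k ∧ a s = i)

lemma plays_eq_blockPlays (B : ℕ) (a : ℕ → Fin K) (t : ℕ) (i : Fin K) :
    plays B a t i = blockPlays B a (t / B) t i := rfl

@[simp]
lemma mem_blockPlays {B : ℕ} {a : ℕ → Fin K} {k t : ℕ} {i : Fin K} {s : ℕ} :
    s ∈ blockPlays B a k t i ↔ s < t ∧ s / B = k ∧ a s = i := by
  simp [blockPlays]

@[simp]
lemma blockPlays_zero (B : ℕ) (a : ℕ → Fin K) (k : ℕ) (i : Fin K) :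
    blockPlays B a k 0 i = ∅ := by simp [blockPlays]

lemma notMem_blockPlays_self (B : ℕ) (a : ℕ → Fin K) (k t : ℕ) (i : Fin K) :
    t ∉ blockPlays B a k t i := by simp

lemma blockPlays_succ_of_play {B : ℕ} {a : ℕ → Fin K} {k t : ℕ} {i : Fin K}
    (h : t / B = k ∧ a t = i) :
    blockPlays B a k (t + 1) i = insert t (blockPlays B a k t i) := by
  ext s
  simp only [mem_blockPlays, Finset.mem_insert]
  constructor
  · rintro ⟨h1, h2⟩
    rcases Nat.lt_succ_iff_lt_or_eq.1 h1 with h3 | rfl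
    · exact Or.inr ⟨h3, h2⟩
    · exact Or.inl rfl
  · rintro (rfl | ⟨h1, h2⟩)
    · exact ⟨by omega, h⟩
    · exact ⟨by omega, h2⟩

lemma blockPlays_succ_of_not_play {B : ℕ} {a : ℕ → Fin K} {k t : ℕ} {i : Fin K}
    (h : ¬ (t / B = k ∧ a t = i)) :
    blockPlays B a k (t + 1) i = blockPlays B a k t i := by
  ext s
  simp only [mem_blockPlays]
  constructor
  · rintro ⟨h1, h2⟩
    rcases Nat.lt_succ_iff_lt_or_eq.1 h1 with h3 | rfl
    · exact ⟨h3, h2⟩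
    · exact absurd h2 h
  · rintro ⟨h1, h2⟩
    exact ⟨by omega, h2⟩

lemma card_blockPlays_le (B : ℕ) (a : ℕ → Fin K) (k t : ℕ) (i : Fin K) :
    (blockPlays B a k t i).card ≤ t := by
  simpa [blockPlays] using Finset.card_filter_le (Finset.range t) (fun s => s / B = k ∧ a s = i)

/-- The mean of the losses of arm `i` seen before step `t` in block `k`. -/
noncomputable def runningMean (B : ℕ) (x : ℕ → Fin K → ℝ) (a : ℕ → Fin K) (k : ℕ) (i : Fin K)
    (t : ℕ) : ℝ :=
  empMean x (blockPlays B a k t i) i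

/-- Predicting each loss by the mean of the earlier ones costs little more, in squared error,
than predicting all of them by their final mean: the `n`-th term of the left side is `n / (n - 1)`
times the corresponding increment of `sumSqDev`. -/
lemma sum_sub_runningMean_sq_le {T B : ℕ} {x : ℕ → Fin K → ℝ} (a : ℕ → Fin K) (k : ℕ)
    (i : Fin K) (hx : ∀ t < T, x t i ∈ Set.Icc (0 : ℝ) 1) {t : ℕ} (ht : t ≤ T) :
    ∑ s ∈ blockPlays B a k t i, (x s i - runningMean B x a k i s) ^ 2 ≤
      3 / 2 * sumSqDev (fun s => x s i) (blockPlays B a k t i) + 5 / 4 := by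
  -- the additive error after `n` plays is `0`, `1` or `5/4` according to `n = 0`, `n = 1`, `n ≥ 2`
  suffices h : ∑ s ∈ blockPlays B a k t i, (x s i - runningMean B x a k i s) ^ 2 ≤
      3 / 2 * sumSqDev (fun s => x s i) (blockPlays B a k t i) +
        (if (blockPlays B a k t i).card = 0 then 0
          else if (blockPlays B a k t i).card = 1 then 1 else 5 / 4) by
    refine h.trans ?_
    split_ifs <;> linarith
  induction t with
  | zero => simp [sumSqDev]
  | succ t ih =>
    have ih := ih (by omega)
    by_cases hp : t / B = k ∧ a t = i
    · have hn := notMem_blockPlays_self B a k t i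
      rw [blockPlays_succ_of_play hp, Finset.sum_insert hn, sumSqDev_insert _ hn,
        Finset.card_insert_of_notMem hn]
      have hc : runningMean B x a k i t ∈ Set.Icc (0 : ℝ) 1 :=
        empMean_mem_Icc fun s hs => hx s (by rw [mem_blockPlays] at hs; omega)
      have hxt := hx t (by omega)
      have hd : (x t i - runningMean B x a k i t) ^ 2 ≤ 1 := by
        rw [sq_le_one_iff_abs_le_one, abs_le]
        exact ⟨by linarith [hc.2, hxt.1], by linarith [hc.1, hxt.2]⟩
      have hd0 := sq_nonneg (x t i - runningMean B x a k i t)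
      have he : (x t i - (∑ r ∈ blockPlays B a k t i, x r i) / (blockPlays B a k t i).card) ^ 2
          = (x t i - runningMean B x a k i t) ^ 2 := by
        rw [runningMean, empMean_eq]
      rw [he]
      set d := (x t i - runningMean B x a k i t) ^ 2
      set S := blockPlays B a k t i
      rcases Nat.lt_or_ge S.card 2 with h2 | h2
      · interval_cases S.card
        · norm_num at ih ⊢
          linarith
        · norm_num at ih ⊢
          linarith
      · rw [if_neg (by omega), if_neg (by omega)]
        rw [if_neg (by omega), if_neg (by omega)] at ih
        have h2' : (2 : ℝ) ≤ S.card := by exact_mod_cast h2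
        have : (2 / 3 : ℝ) ≤ S.card / (S.card + 1) := by
          rw [div_le_div_iff₀ (by norm_num) (by positivity)]
          linarith
        nlinarith
    · rw [blockPlays_succ_of_not_play hp]
      exact ih

/-! ### The exponential inequality and the choice of its parameter -/

/-- An exponential with a quadratic correction is dominated by a linear function on
`[-1, ∞)`; the sharpness of the correction near `0` is what gives the variance term its
constant. -/
lemma exp_sub_sq_le_one_add {θ ξ : ℝ} (h0 : 0 < θ) (h1 : θ < 1) (hξ : -1 ≤ ξ) :
    Real.exp (θ * ξ - θ ^ 2 / (2 * (1 - θ)) * ξ ^ 2) ≤ 1 + θ * ξ := by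
  have hu : 0 < 1 + θ * ξ := by nlinarith
  have h1' : 0 < 1 - θ := by linarith
  rw [← Real.le_log_iff_exp_le hu]
  set u := θ * ξ with hu_def
  have e : θ ^ 2 / (2 * (1 - θ)) * ξ ^ 2 = u ^ 2 / (2 * (1 - θ)) := by rw [hu_def]; ring
  rw [e]
  rcases le_total 0 u with h | h
  · have h2 := Real.le_log_one_add_of_nonneg h
    have h3 : u ^ 2 / (u + 2) ≤ u ^ 2 / (2 * (1 - θ)) :=
      div_le_div_of_nonneg_left (by positivity) (by positivity) (by linarith)
    have h4 : 2 * u / (u + 2) = u - u ^ 2 / (u + 2) := by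
      field_simp
      ring
    linarith
  · -- for `y ≤ 1`, `log y ≥ sinh (log y) = (y - 1 / y) / 2`
    have h2 := Real.sinh_le_self_iff.2 (Real.log_nonpos hu.le (by linarith))
    rw [Real.sinh_log hu] at h2
    have h3 : u ^ 2 / (2 * (1 + u)) ≤ u ^ 2 / (2 * (1 - θ)) :=
      div_le_div_of_nonneg_left (by positivity) (by positivity) (by nlinarith)
    have h4 : ((1 + u) - (1 + u)⁻¹) / 2 = u - u ^ 2 / (2 * (1 + u)) := by
      field_simp
      ring
    linarith

/-- Optimizing the linearized deviation bound over the dyadic grid `g = 2 ^ j`. The bound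
`15 / 8 ≤ L` absorbs the additive constant of `sum_sub_runningMean_sq_le`. -/
lemma deviation_le_of_grid {L Q R M : ℝ} {T : ℕ} (hL : 15 / 8 ≤ L) (hQ0 : 0 ≤ Q) (hQT : Q ≤ T)
    (hR : R ≤ 3 / 2 * Q + 5 / 4)
    (h : ∀ j ∈ Finset.range (Nat.log 2 T + 1),
      M ≤ (1 + (2 : ℝ) ^ j) * L + R / (2 * (2 : ℝ) ^ j)) :
    M ≤ 2 * √(L * Q) + 7 / 3 * L := by
  have hL0 : 0 < L := by linarith
  have key (j : ℕ) (hj : j ∈ Finset.range (Nat.log 2 T + 1)) :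
      M ≤ 4 / 3 * L + (2 : ℝ) ^ j * L + 3 / 4 * Q / (2 : ℝ) ^ j := by
    have h1 := h j hj
    have hg : (1 : ℝ) ≤ 2 ^ j := one_le_pow₀ (by norm_num)
    set g : ℝ := 2 ^ j
    have h2 : R / (2 * g) ≤ 3 / 4 * Q / g + 5 / 8 := by
      rw [div_add' _ _ _ (by positivity), div_le_div_iff₀ (by positivity) (by positivity)]
      have : 0 ≤ g * g - g := by nlinarith
      nlinarith
    linarith
  set q := √(Q / L) with hq
  have hq0 : 0 ≤ q := Real.sqrt_nonneg _
  have hQq : Q = q ^ 2 * L := by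
    rw [hq, Real.sq_sqrt (by positivity)]
    field_simp
  have hs : √(L * Q) = q * L := by
    rw [hQq, show L * (q ^ 2 * L) = (q * L) ^ 2 by ring, Real.sqrt_sq (by positivity)]
  rw [hs]
  rcases le_total q 1 with h1 | h1
  · have := key 0 (by simp)
    rw [pow_zero, div_one, hQq] at this
    nlinarith [mul_nonneg hq0 hL0.le, mul_nonneg (mul_nonneg hq0 hL0.le) (sub_nonneg.2 h1)]
  · -- choose `2 ^ j ≤ q < 2 ^ (j + 1)`
    have hfl : ⌊q⌋₊ ≠ 0 := (Nat.floor_pos.2 h1).ne'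
    have hqT : q ≤ T := by
      have : q ^ 2 ≤ T := by
        rw [hq, Real.sq_sqrt (by positivity)]
        exact (div_le_self hQ0 (by linarith)).trans hQT
      nlinarith
    have hj := key (Nat.log 2 ⌊q⌋₊) (by
      rw [Finset.mem_range, Nat.lt_succ_iff]
      exact Nat.log_mono_right (Nat.floor_le_of_le hqT))
    have hlo : (2 : ℝ) ^ Nat.log 2 ⌊q⌋₊ ≤ q :=
      le_trans (by exact_mod_cast Nat.pow_log_le_self 2 hfl) (Nat.floor_le hq0)
    have hhi : q ≤ 2 * (2 : ℝ) ^ Nat.log 2 ⌊q⌋₊ := by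
      have h3 := Nat.lt_pow_succ_log_self (b := 2) (by norm_num) ⌊q⌋₊
      have h4 : q < ((2 ^ (Nat.log 2 ⌊q⌋₊ + 1) : ℕ) : ℝ) :=
        (Nat.lt_of_floor_lt h3)
      push_cast at h4
      rw [pow_succ] at h4
      linarith
    set g : ℝ := 2 ^ Nat.log 2 ⌊q⌋₊
    have hg : 0 < g := by linarith
    have h5 : g + 3 / 4 * q ^ 2 / g ≤ 2 * q := by
      rw [← sub_nonneg]
      have : 2 * q - (g + 3 / 4 * q ^ 2 / g) = (3 / 2 * q - g) * (g - q / 2) / g := by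
        field_simp
        ring
      rw [this]
      exact div_nonneg (mul_nonneg (by linarith) (by linarith)) hg.le
    have h6 : 3 / 4 * Q / g = 3 / 4 * q ^ 2 / g * L := by rw [hQq]; ring
    rw [h6] at hj
    nlinarith [mul_le_mul_of_nonneg_right h5 hL0.le]

end RerunUCBV

namespace RerunUCBV

/-! ### A maximal inequality -/

/-- Ville's maximal inequality on a finite horizon, with the supermartingale property stated
through integrals over past events. -/
lemma measureReal_exists_le_le {Ω : Type*} {mΩ : MeasurableSpace Ω} {P : Measure Ω}
    [IsProbabilityMeasure P] {ℱ : Filtration ℕ mΩ} {Z : ℕ → Ω → ℝ} {T : ℕ} {c : ℝ} (hc : 0 < c)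
    (hZ : ∀ t ω, 0 ≤ Z t ω) (hZ0 : ∀ ω, Z 0 ω = 1)
    (hmeas : ∀ t ≤ T, Measurable[ℱ t] (Z t)) (hint : ∀ t ≤ T, Integrable (Z t) P)
    (hsuper : ∀ t < T, ∀ A, MeasurableSet[ℱ t] A → ∫ ω in A, Z (t + 1) ω ∂P ≤ ∫ ω in A, Z t ω ∂P) :
    P.real {ω | ∃ t ≤ T, c ≤ Z t ω} ≤ c⁻¹ := by
  let A (n : ℕ) : Set Ω := {ω | ∀ t < n, Z t ω < c}
  have hAsucc (n : ℕ) : A (n + 1) = A n ∩ {ω | Z n ω < c} := by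
    ext ω
    simp only [A, Set.mem_ofPred_eq, Set.mem_inter_iff]
    constructor
    · exact fun h => ⟨fun t ht => h t (by omega), h n (by omega)⟩
    · rintro ⟨h1, h2⟩ t ht
      rcases Nat.lt_succ_iff_lt_or_eq.1 ht with h3 | rfl
      · exact h1 t h3
      · exact h2
  have hAmeas (n : ℕ) (hn : n ≤ T) : MeasurableSet[ℱ n] (A n ∩ {ω | Z n ω < c}) ∧
      MeasurableSet[ℱ n] (A n) := by
    have h1 (t : ℕ) (ht : t ≤ n) : MeasurableSet[ℱ n] {ω | Z t ω < c} :=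
      ℱ.mono ht _ (hmeas t (by omega) measurableSet_Iio)
    have h2 : MeasurableSet[ℱ n] (A n) := by
      have : A n = ⋂ t ∈ Finset.range n, {ω | Z t ω < c} := by
        ext ω
        simp [A]
      rw [this]
      exact Finset.measurableSet_biInter _ fun t ht => h1 t (by
        rw [Finset.mem_range] at ht
        omega)
    exact ⟨h2.inter (h1 n le_rfl), h2⟩
  -- the mass of `Z n` on the paths that stayed below `c`, plus `c` times the mass of the others
  have key (n : ℕ) (hn : n ≤ T) : ∫ ω in A n, Z n ω ∂P + c * P.real (A n)ᶜ ≤ 1 := by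
    induction n with
    | zero => simp [A, hZ0]
    | succ n ih =>
      have ih := ih (by omega)
      obtain ⟨h1, h2⟩ := hAmeas n (by omega)
      have h1' := ℱ.le n _ h1
      have h2' := ℱ.le n _ h2
      have h3 := hsuper n (by omega) _ h1
      rw [← hAsucc] at h1 h1' h3
      have hd : A n \ A (n + 1) ⊆ A n := Set.sdiff_subset
      have h4 : ∫ ω in A n, Z n ω ∂P
          = ∫ ω in A (n + 1), Z n ω ∂P + ∫ ω in A n \ A (n + 1), Z n ω ∂P := by
        have hsub : A (n + 1) ⊆ A n := by
          rw [hAsucc]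
          exact Set.inter_subset_left
        rw [← setIntegral_union Set.disjoint_sdiff_right (h2'.diff h1')
          (hint n (by omega)).integrableOn (hint n (by omega)).integrableOn,
          Set.union_sdiff_cancel hsub]
      have h5 : c * P.real (A n \ A (n + 1)) ≤ ∫ ω in A n \ A (n + 1), Z n ω ∂P := by
        have := setIntegral_ge_of_const_le_real (μ := P) (f := Z n) (c := c) (h2'.diff h1')
          (measure_ne_top _ _) (fun ω hω => by
            have h6 := hω.2
            rw [hAsucc] at h6
            by_contra h7
            exact h6 ⟨hω.1, not_le.1 h7⟩) (hint n (by omega)).integrableOn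
        exact this
      have h6 : P.real (A (n + 1))ᶜ ≤ P.real (A n)ᶜ + P.real (A n \ A (n + 1)) := by
        refine (measureReal_mono ?_).trans (measureReal_union_le _ _)
        intro ω hω
        by_cases h : ω ∈ A n
        · exact Or.inr ⟨h, hω⟩
        · exact Or.inl h
      nlinarith
  have h1 := key T le_rfl
  obtain ⟨h2, h3⟩ := hAmeas T le_rfl
  have h2' := ℱ.le T _ h2
  have h3' := ℱ.le T _ h3
  have h4 : c * P.real (A T ∩ {ω | Z T ω < c}ᶜ) ≤ ∫ ω in A T, Z T ω ∂P := by
    have hm : MeasurableSet {ω | Z T ω < c} := ℱ.le T _ (hmeas T le_rfl measurableSet_Iio)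
    refine (setIntegral_ge_of_const_le_real (μ := P) (f := Z T) (h3'.inter hm.compl)
      (measure_ne_top _ _) (fun ω hω => not_lt.1 hω.2)
      (hint T le_rfl).integrableOn).trans ?_
    exact setIntegral_mono_set (hint T le_rfl).integrableOn (Filter.Eventually.of_forall (hZ T))
      (LE.le.eventuallyLE Set.inter_subset_left)
  have h5 : P.real {ω | ∃ t ≤ T, c ≤ Z t ω} ≤
      P.real (A T)ᶜ + P.real (A T ∩ {ω | Z T ω < c}ᶜ) := by
    refine (measureReal_mono ?_).trans (measureReal_union_le _ _)
    rintro ω ⟨t, ht, hω⟩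
    by_cases h : ω ∈ A T
    · refine Or.inr ⟨h, ?_⟩
      rcases ht.lt_or_eq with h6 | rfl
      · exact absurd (h t h6) (not_lt.2 hω)
      · exact not_lt.2 hω
    · exact Or.inl h
  rw [← one_div, le_div_iff₀ hc]
  nlinarith

/-! ### The stochastic model -/

variable {K : ℕ} {Ω : Type*}

lemma measurable_sum_blockPlays [MeasurableSpace Ω] {a : ℕ → Ω → Fin K} {f : ℕ → Ω → ℝ} {t : ℕ}
    (ha : ∀ s < t, Measurable (a s)) (hf : ∀ s < t, Measurable (f s)) (B k : ℕ) (i : Fin K) :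
    Measurable fun ω => ∑ s ∈ blockPlays B (fun s => a s ω) k t i, f s ω := by
  simp only [blockPlays, Finset.sum_filter]
  refine Finset.measurable_sum _ fun s hs => ?_
  rw [Finset.mem_range] at hs
  by_cases hk : s / B = k
  · simp only [hk, true_and]
    exact Measurable.ite (ha s hs (measurableSet_singleton i)) (hf s hs) measurable_const
  · simp [hk]

lemma measurable_card_blockPlays [MeasurableSpace Ω] {a : ℕ → Ω → Fin K} {t : ℕ}
    (ha : ∀ s < t, Measurable (a s)) (B k : ℕ) (i : Fin K) :
    Measurable fun ω => ((blockPlays B (fun s => a s ω) k t i).card : ℝ) := by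
  have := measurable_sum_blockPlays (f := fun _ _ => 1) ha (fun _ _ => measurable_const) B k i
  simpa using this

variable {mΩ : MeasurableSpace Ω}

/-- Losses in `[0, 1]`, each independent of the past, and a learner who does not look ahead. -/
structure IsEnvironment (T : ℕ) (P : Measure Ω) (ℱ : Filtration ℕ mΩ) (ℓ : ℕ → Ω → Fin K → ℝ)
    (a : ℕ → Ω → Fin K) : Prop where
  loss_mem : ∀ t < T, ∀ ω, ∀ i, ℓ t ω i ∈ Set.Icc (0 : ℝ) 1
  measurable_loss : ∀ t < T, Measurable[ℱ (t + 1)] (ℓ t)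
  indep : ∀ t < T, Indep (MeasurableSpace.comap (ℓ t) inferInstance) (ℱ t) P
  measurable_arm : ∀ t < T, Measurable[ℱ t] (a t)

namespace IsEnvironment

variable {T : ℕ} {P : Measure Ω} {ℱ : Filtration ℕ mΩ}
  {ℓ : ℕ → Ω → Fin K → ℝ} {a : ℕ → Ω → Fin K}

lemma measurable_arm_of_lt (h : IsEnvironment T P ℱ ℓ a) {s t : ℕ} (hst : s < t) (ht : t ≤ T) :
    Measurable[ℱ t] (a s) :=
  (h.measurable_arm s (by omega)).mono (ℱ.mono hst.le) le_rfl

lemma measurable_loss_of_lt (h : IsEnvironment T P ℱ ℓ a) {s t : ℕ} (hst : s < t) (ht : t ≤ T)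
    (i : Fin K) : Measurable[ℱ t] (fun ω => ℓ s ω i) :=
  (measurable_pi_apply i).comp ((h.measurable_loss s (by omega)).mono (ℱ.mono hst) le_rfl)

lemma measurable_loss_apply (h : IsEnvironment T P ℱ ℓ a) {t : ℕ} (ht : t < T) (i : Fin K) :
    Measurable (fun ω => ℓ t ω i) :=
  (h.measurable_loss_of_lt (Nat.lt_succ_self t) ht i).mono (ℱ.le _) le_rfl

lemma measurable_runningMean (h : IsEnvironment T P ℱ ℓ a) {t : ℕ} (ht : t ≤ T) (B k : ℕ)
    (i : Fin K) :
    Measurable[ℱ t] fun ω => runningMean B (fun s => ℓ s ω) (fun s => a s ω) k i t := by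
  simp only [runningMean, empMean_eq]
  have h1 := @measurable_sum_blockPlays K Ω (ℱ t) a (fun s ω => ℓ s ω i) t
    (fun s hs => h.measurable_arm_of_lt hs ht) (fun s hs => h.measurable_loss_of_lt hs ht i) B k i
  have h2 := @measurable_card_blockPlays K Ω (ℱ t) a t
    (fun s hs => h.measurable_arm_of_lt hs ht) B k i
  exact h1.div h2

variable [IsProbabilityMeasure P]

lemma integrable_loss (h : IsEnvironment T P ℱ ℓ a) {t : ℕ} (ht : t < T) (i : Fin K) :
    Integrable (fun ω => ℓ t ω i) P :=
  Integrable.of_bound (h.measurable_loss_apply ht i).aestronglyMeasurable 1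
    (Filter.Eventually.of_forall fun ω => by
      rw [Real.norm_of_nonneg (h.loss_mem t ht ω i).1]
      exact (h.loss_mem t ht ω i).2)

lemma mean_mem (h : IsEnvironment T P ℱ ℓ a) {t : ℕ} (ht : t < T) (i : Fin K) :
    mean P ℓ t i ∈ Set.Icc (0 : ℝ) 1 := by
  refine ⟨integral_nonneg fun ω => (h.loss_mem t ht ω i).1, ?_⟩
  have := integral_mono (h.integrable_loss ht i) (integrable_const (μ := P) (1 : ℝ))
    fun ω => (h.loss_mem t ht ω i).2
  simpa [mean] using this

/-- The noise of a loss is orthogonal to the past. -/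
lemma integral_mul_loss_sub_mean (h : IsEnvironment T P ℱ ℓ a) {t : ℕ} (ht : t < T) (i : Fin K)
    {H : Ω → ℝ} (hH : Measurable[ℱ t] H) :
    ∫ ω, H ω * (ℓ t ω i - mean P ℓ t i) ∂P = 0 := by
  have hind : IndepFun H (fun ω => ℓ t ω i - mean P ℓ t i) P := by
    rw [IndepFun_iff_Indep]
    refine (indep_of_indep_of_le (h.indep t ht) ?_ hH.comap_le).symm
    have : Measurable fun y : Fin K → ℝ => y i - mean P ℓ t i :=
      (measurable_pi_apply i).sub_const _
    have h2 := this.comp (comap_measurable (ℓ t))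
    exact h2.comap_le
  have h1 := hind.integral_mul_eq_mul_integral
    (hH.mono (ℱ.le t) le_rfl).aestronglyMeasurable
    ((h.measurable_loss_apply ht i).sub_const _).aestronglyMeasurable
  have h2 : ∫ ω, (ℓ t ω i - mean P ℓ t i) ∂P = 0 := by
    rw [integral_sub (h.integrable_loss ht i) (integrable_const _)]
    simp [mean]
  rw [h2, mul_zero] at h1
  exact h1

end IsEnvironment

/-! ### The exponential supermartingale of one arm in one block -/

/-- The logarithm of the exponential supermartingale that controls the upper (`σ = 1`) or lower
(`σ = -1`) deviations of the losses of arm `i` in block `k`. The quadratic compensator is centred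
at the running empirical mean, so that it is an observed quantity. -/
noncomputable def logWealth (B : ℕ) (x μ : ℕ → Fin K → ℝ) (a : ℕ → Fin K) (k : ℕ) (i : Fin K)
    (θ σ : ℝ) (t : ℕ) : ℝ :=
  ∑ s ∈ blockPlays B a k t i, (θ * (σ * (x s i - μ s i))
    - θ ^ 2 / (2 * (1 - θ)) * (x s i - runningMean B x a k i s) ^ 2)

/-- One step of the wealth process is at most `1` plus a predictable multiple of the noise. -/
lemma exp_increment_le {θ σ x μ c : ℝ} (h0 : 0 < θ) (h1 : θ < 1) (hσ : σ = 1 ∨ σ = -1)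
    (hx : x ∈ Set.Icc (0 : ℝ) 1) (hc : c ∈ Set.Icc (0 : ℝ) 1) :
    Real.exp (θ * (σ * (x - μ)) - θ ^ 2 / (2 * (1 - θ)) * (x - c) ^ 2) ≤
      1 + θ * σ * Real.exp (-(θ * σ * (μ - c))) * (x - μ) := by
  have hξ : -1 ≤ σ * (x - c) := by
    rcases hσ with rfl | rfl <;> linarith [hx.1, hx.2, hc.1, hc.2]
  have hsq : (x - c) ^ 2 = (σ * (x - c)) ^ 2 := by
    rcases hσ with rfl | rfl <;> ring
  have h2 := exp_sub_sq_le_one_add h0 h1 hξ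
  rw [← hsq] at h2
  set v := θ * σ * (μ - c) with hv
  have e : θ * (σ * (x - μ)) - θ ^ 2 / (2 * (1 - θ)) * (x - c) ^ 2
      = -v + (θ * (σ * (x - c)) - θ ^ 2 / (2 * (1 - θ)) * (x - c) ^ 2) := by
    rw [hv]
    ring
  rw [e, Real.exp_add]
  have h3 : Real.exp (-v) * (1 + v) ≤ 1 := by
    have := mul_le_mul_of_nonneg_left (Real.add_one_le_exp v) (Real.exp_pos (-v)).le
    rw [← Real.exp_add] at this
    simpa [add_comm] using this
  have h4 := mul_le_mul_of_nonneg_left h2 (Real.exp_pos (-v)).le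
  have h5 : Real.exp (-v) * (1 + θ * (σ * (x - c)))
      = Real.exp (-v) * (1 + v) + θ * σ * Real.exp (-v) * (x - μ) := by
    rw [hv]
    ring
  linarith

lemma logWealth_succ (B : ℕ) (x μ : ℕ → Fin K → ℝ) (a : ℕ → Fin K) (k : ℕ) (i : Fin K)
    (θ σ : ℝ) (t : ℕ) :
    logWealth B x μ a k i θ σ (t + 1) = logWealth B x μ a k i θ σ t +
      if t / B = k ∧ a t = i then θ * (σ * (x t i - μ t i))
        - θ ^ 2 / (2 * (1 - θ)) * (x t i - runningMean B x a k i t) ^ 2 else 0 := by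
  unfold logWealth
  split_ifs with hp
  · rw [blockPlays_succ_of_play hp, Finset.sum_insert (notMem_blockPlays_self B a k t i), add_comm]
  · rw [blockPlays_succ_of_not_play hp, add_zero]

namespace IsEnvironment

variable {T : ℕ} {P : Measure Ω} {ℱ : Filtration ℕ mΩ}
  {ℓ : ℕ → Ω → Fin K → ℝ} {a : ℕ → Ω → Fin K}

lemma measurable_logWealth (h : IsEnvironment T P ℱ ℓ a) {t : ℕ} (ht : t ≤ T) (B k : ℕ)
    (i : Fin K) (θ σ : ℝ) : Measurable[ℱ t] fun ω =>
      logWealth B (fun s => ℓ s ω) (mean P ℓ) (fun s => a s ω) k i θ σ t := by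
  unfold logWealth
  refine @measurable_sum_blockPlays K Ω (ℱ t) a _ t
    (fun s hs => h.measurable_arm_of_lt hs ht) (fun s hs => ?_) B k i
  have h1 := h.measurable_loss_of_lt hs ht i
  have h2 : Measurable[ℱ t] fun ω =>
      runningMean B (fun s => ℓ s ω) (fun s => a s ω) k i s :=
    (h.measurable_runningMean (hs.le.trans ht) B k i).mono (ℱ.mono hs.le) le_rfl
  let _ := ℱ t
  exact (((h1.sub_const _).const_mul σ).const_mul θ).sub (((h1.sub h2).pow_const 2).const_mul _)

variable [IsProbabilityMeasure P]

lemma logWealth_le (h : IsEnvironment T P ℱ ℓ a) {t : ℕ} (ht : t ≤ T) (B k : ℕ)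
    (i : Fin K) {θ σ : ℝ} (h0 : 0 < θ) (h1 : θ < 1) (hσ : σ = 1 ∨ σ = -1) (ω : Ω) :
    logWealth B (fun s => ℓ s ω) (mean P ℓ) (fun s => a s ω) k i θ σ t ≤ t := by
  have hterm : ∀ s ∈ blockPlays B (fun s => a s ω) k t i,
      (θ * (σ * (ℓ s ω i - mean P ℓ s i)) - θ ^ 2 / (2 * (1 - θ)) *
        (ℓ s ω i - runningMean B (fun s => ℓ s ω) (fun s => a s ω) k i s) ^ 2) ≤ 1 := by
    intro s hs
    rw [mem_blockPlays] at hs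
    have hx := h.loss_mem s (by omega) ω i
    have hm := h.mean_mem (t := s) (by omega) i
    have h2 : 0 ≤ θ ^ 2 / (2 * (1 - θ)) *
        (ℓ s ω i - runningMean B (fun s => ℓ s ω) (fun s => a s ω) k i s) ^ 2 := by
      have : 0 < 1 - θ := by linarith
      positivity
    have h3 : σ * (ℓ s ω i - mean P ℓ s i) ≤ 1 := by
      rcases hσ with rfl | rfl <;> linarith [hx.1, hx.2, hm.1, hm.2]
    nlinarith
  refine (Finset.sum_le_sum hterm).trans ?_
  simpa using card_blockPlays_le B (fun s => a s ω) k t i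

/-- The probability that the log-wealth ever reaches `L` is at most `exp (-L)`. -/
lemma measureReal_exists_le_logWealth (h : IsEnvironment T P ℱ ℓ a) (B k : ℕ)
    (i : Fin K) {θ σ : ℝ} (h0 : 0 < θ) (h1 : θ < 1) (hσ : σ = 1 ∨ σ = -1) (L : ℝ) :
    P.real {ω | ∃ t ≤ T, L ≤
      logWealth B (fun s => ℓ s ω) (mean P ℓ) (fun s => a s ω) k i θ σ t} ≤ Real.exp (-L) := by
  let X (t : ℕ) (ω : Ω) : ℝ :=
    logWealth B (fun s => ℓ s ω) (mean P ℓ) (fun s => a s ω) k i θ σ t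
  have hXm (t : ℕ) (ht : t ≤ T) : Measurable[ℱ t] fun ω => Real.exp (X t ω) :=
    Real.measurable_exp.comp (h.measurable_logWealth ht B k i θ σ)
  have hXb (t : ℕ) (ht : t ≤ T) (ω : Ω) : Real.exp (X t ω) ≤ Real.exp t :=
    Real.exp_le_exp.2 (h.logWealth_le ht B k i h0 h1 hσ ω)
  have hXi (t : ℕ) (ht : t ≤ T) : Integrable (fun ω => Real.exp (X t ω)) P :=
    Integrable.of_bound ((hXm t ht).mono (ℱ.le t) le_rfl).aestronglyMeasurable (Real.exp t)
      (Filter.Eventually.of_forall fun ω => by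
        rw [Real.norm_of_nonneg (Real.exp_pos _).le]
        exact hXb t ht ω)
  have hmax := measureReal_exists_le_le (P := P) (ℱ := ℱ) (Z := fun t ω => Real.exp (X t ω))
    (T := T) (Real.exp_pos L) (fun t ω => (Real.exp_pos _).le) (fun ω => by simp [X, logWealth])
    hXm hXi ?_
  · simp only [Real.exp_le_exp] at hmax
    rw [Real.exp_neg]
    exact hmax
  intro t ht A hA
  -- the wealth at `t + 1` is at most the wealth at `t` plus a past factor times the noise
  let c (ω : Ω) : ℝ := runningMean B (fun s => ℓ s ω) (fun s => a s ω) k i t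
  have hc (ω : Ω) : c ω ∈ Set.Icc (0 : ℝ) 1 := empMean_mem_Icc fun s hs =>
    h.loss_mem s (by rw [mem_blockPlays] at hs; omega) ω i
  have hcm : Measurable[ℱ t] c := h.measurable_runningMean ht.le B k i
  let D : Set Ω := A ∩ {ω | t / B = k ∧ a t ω = i}
  have hD : MeasurableSet[ℱ t] D := by
    refine hA.inter ?_
    by_cases hk : t / B = k
    · simp only [hk, true_and]
      exact h.measurable_arm t ht (measurableSet_singleton i)
    · simp [hk]
  let H (ω : Ω) : ℝ := D.indicator
    (fun ω => Real.exp (X t ω) * (θ * σ * Real.exp (-(θ * σ * (mean P ℓ t i - c ω))))) ω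
  have hm := h.mean_mem ht i
  have hHm : Measurable[ℱ t] H := by
    have h2 : Measurable[ℱ t] fun ω => -(θ * σ * (mean P ℓ t i - c ω)) := by
      let _ := ℱ t
      exact ((hcm.const_sub _).const_mul _).neg
    have h3 : Measurable[ℱ t] fun ω => Real.exp (-(θ * σ * (mean P ℓ t i - c ω))) :=
      Real.measurable_exp.comp h2
    let _ := ℱ t
    exact ((hXm t ht.le).mul (h3.const_mul _)).indicator hD
  have habs : |θ * σ| ≤ 1 := by
    rw [abs_le]
    rcases hσ with rfl | rfl <;> constructor <;> linarith
  have hHb (ω : Ω) : ‖H ω‖ ≤ Real.exp t * Real.exp 1 := by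
    refine (norm_indicator_le_norm_self _ _).trans ?_
    rw [norm_mul, norm_mul, Real.norm_of_nonneg (Real.exp_pos _).le,
      Real.norm_of_nonneg (Real.exp_pos _).le, Real.norm_eq_abs]
    refine mul_le_mul (hXb t ht.le ω) ?_ (by positivity) (by positivity)
    have h2 : -(θ * σ * (mean P ℓ t i - c ω)) ≤ 1 := by
      refine (neg_le_abs _).trans ?_
      rw [abs_mul]
      refine mul_le_one₀ habs (abs_nonneg _) ?_
      rw [abs_le]
      constructor <;> linarith [hm.1, hm.2, (hc ω).1, (hc ω).2]
    have h3 := Real.exp_le_exp.2 h2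
    have h4 := Real.exp_pos (-(θ * σ * (mean P ℓ t i - c ω)))
    nlinarith
  have hHi : Integrable H P := Integrable.of_bound
    (hHm.mono (ℱ.le t) le_rfl).aestronglyMeasurable _ (Filter.Eventually.of_forall hHb)
  have hzero := h.integral_mul_loss_sub_mean ht i hHm
  have hHxi : Integrable (fun ω => H ω * (ℓ t ω i - mean P ℓ t i)) P := by
    refine hHi.mul_bdd (c := 1)
      ((h.measurable_loss_apply ht i).sub_const _).aestronglyMeasurable
      (Filter.Eventually.of_forall fun ω => ?_)
    have hx := h.loss_mem t ht ω i
    rw [Real.norm_eq_abs, abs_le]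
    constructor <;> linarith [hm.1, hm.2, hx.1, hx.2]
  have hA' := ℱ.le t _ hA
  rw [← integral_indicator hA', ← integral_indicator hA']
  calc ∫ ω, A.indicator (fun ω => Real.exp (X (t + 1) ω)) ω ∂P
      ≤ ∫ ω, (A.indicator (fun ω => Real.exp (X t ω)) ω + H ω * (ℓ t ω i - mean P ℓ t i)) ∂P := by
        refine integral_mono ((hXi (t + 1) ht).indicator hA')
          (((hXi t ht.le).indicator hA').add hHxi) fun ω => ?_
        by_cases hωA : ω ∈ A
        · by_cases hp : t / B = k ∧ a t ω = i
          · have e : X (t + 1) ω = X t ω + (θ * (σ * (ℓ t ω i - mean P ℓ t i))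
                - θ ^ 2 / (2 * (1 - θ)) * (ℓ t ω i - c ω) ^ 2) := by
              simp only [X, c]
              rw [logWealth_succ, if_pos hp]
            have hH : H ω = Real.exp (X t ω) *
                (θ * σ * Real.exp (-(θ * σ * (mean P ℓ t i - c ω)))) :=
              Set.indicator_of_mem (show ω ∈ D from ⟨hωA, hp⟩) _
            have h3 := exp_increment_le (μ := mean P ℓ t i) h0 h1 hσ
              (h.loss_mem t ht ω i) (hc ω)
            simp only [Set.indicator_of_mem hωA]
            rw [e, Real.exp_add, hH]
            have h4 := mul_le_mul_of_nonneg_left h3 (Real.exp_pos (X t ω)).le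
            linarith
          · have e : X (t + 1) ω = X t ω := by
              simp only [X]
              rw [logWealth_succ, if_neg hp, add_zero]
            have hH : H ω = 0 := Set.indicator_of_notMem (fun h => hp h.2) _
            simp only [Set.indicator_of_mem hωA]
            rw [e, hH, zero_mul, add_zero]
        · have hH : H ω = 0 := Set.indicator_of_notMem (fun h => hωA h.1) _
          simp [hωA, hH]
    _ = ∫ ω, A.indicator (fun ω => Real.exp (X t ω)) ω ∂P := by
        rw [integral_add ((hXi t ht.le).indicator hA') hHxi, hzero, add_zero]

end IsEnvironment

end RerunUCBV

namespace RerunUCBV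

variable {K : ℕ}

/-! ### Regret along a path on which the confidence intervals hold -/

/-- The confidence intervals of block `k` hold along the path: none of the log-wealth processes of
the block, for either sign and any parameter of the dyadic grid, ever reaches `L`. -/
def IsGoodBlock (L : ℝ) (T B : ℕ) (x μ : ℕ → Fin K → ℝ) (a : ℕ → Fin K) (k : ℕ) : Prop :=
  ∀ i : Fin K, ∀ j ∈ Finset.range (Nat.log 2 T + 1), ∀ σ : ℝ, σ = 1 ∨ σ = -1 → ∀ t ≤ T,
    logWealth B x μ a k i (1 / (1 + 2 ^ j)) σ t < L

/-- The total drift within block `k`, where `v u` is the drift from step `u - 1` to step `u`. -/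
def blockDrift (v : ℕ → ℝ) (T B k : ℕ) : ℝ :=
  ∑ u ∈ (Finset.range T).filter (fun u => u / B = k), v u

section Path

variable {T B : ℕ} {L δ : ℝ} {x μ : ℕ → Fin K → ℝ} {a : ℕ → Fin K} {v : ℕ → ℝ}

lemma IsGoodBlock.deviation_le {k : ℕ} (hg : IsGoodBlock L T B x μ a k) (hL : 15 / 8 ≤ L)
    (hx : ∀ t < T, ∀ i, x t i ∈ Set.Icc (0 : ℝ) 1) {t : ℕ} (ht : t ≤ T) (i : Fin K)
    {σ : ℝ} (hσ : σ = 1 ∨ σ = -1) :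
    σ * ∑ s ∈ blockPlays B a k t i, (x s i - μ s i) ≤
      2 * √(L * sumSqDev (fun s => x s i) (blockPlays B a k t i)) + 7 / 3 * L := by
  refine deviation_le_of_grid (T := T) hL (sumSqDev_nonneg _ _) ?_
    (sum_sub_runningMean_sq_le (T := T) a k i (fun t ht => hx t ht i) ht) fun j hj => ?_
  · have h1 : ∑ s ∈ blockPlays B a k t i, (x s i - 0) ^ 2 ≤ ∑ s ∈ blockPlays B a k t i, 1 := by
      refine Finset.sum_le_sum fun s hs => ?_
      rw [mem_blockPlays] at hs
      have := hx s (by omega) i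
      rw [sub_zero]
      exact pow_le_one₀ this.1 this.2
    refine (sumSqDev_le _ _ 0).trans (h1.trans ?_)
    simpa using (card_blockPlays_le B a k t i).trans ht
  · have h1 := (hg i j hj σ hσ t ht).le
    have hg0 : (0 : ℝ) < 2 ^ j := by positivity
    simp only [logWealth, Finset.sum_sub_distrib, ← Finset.mul_sum] at h1 ⊢
    set g : ℝ := 2 ^ j
    set R := ∑ s ∈ blockPlays B a k t i, (x s i - runningMean B x a k i s) ^ 2
    set M := σ * (∑ s ∈ blockPlays B a k t i, x s i - ∑ s ∈ blockPlays B a k t i, μ s i)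
    have e : 1 / (1 + g) * M - (1 / (1 + g)) ^ 2 / (2 * (1 - 1 / (1 + g))) * R
        = (M - R / (2 * g)) / (1 + g) := by
      have : 1 - 1 / (1 + g) = g / (1 + g) := by
        field_simp
        ring
      rw [this]
      field_simp
    rw [e, div_le_iff₀ (by positivity)] at h1
    linarith

lemma blockDrift_nonneg (hv0 : ∀ u, 0 ≤ v u) (k : ℕ) : 0 ≤ blockDrift v T B k :=
  Finset.sum_nonneg fun _ _ => hv0 _

lemma abs_sub_le_blockDrift (hv0 : ∀ u, 0 ≤ v u)
    (hv : ∀ s i, |μ (s + 1) i - μ s i| ≤ v (s + 1)) {r s k : ℕ} (hr : r < T) (hs : s < T)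
    (hrk : r / B = k) (hsk : s / B = k) (i : Fin K) :
    |μ s i - μ r i| ≤ blockDrift v T B k := by
  wlog h : r ≤ s generalizing r s
  · rw [abs_sub_comm]
    exact this hs hr hsk hrk (by omega)
  have h1 : |μ s i - μ r i| ≤ ∑ u ∈ Finset.Ico (r + 1) (s + 1), v u := by
    clear hs hsk
    induction s, h using Nat.le_induction with
    | base => simp
    | succ s hrs ih =>
      rw [Finset.sum_Ico_succ_top (by omega)]
      have := abs_sub_le (μ (s + 1) i) (μ s i) (μ r i)
      linarith [hv s i]
  refine h1.trans (Finset.sum_le_sum_of_subset_of_nonneg (fun u hu => ?_) fun u _ _ => hv0 u)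
  rw [Finset.mem_Ico] at hu
  rw [Finset.mem_filter, Finset.mem_range]
  refine ⟨by omega, le_antisymm ?_ ?_⟩
  · rw [← hsk]
    exact Nat.div_le_div_right (by omega)
  · rw [← hrk]
    exact Nat.div_le_div_right (by omega)

lemma card_filter_div_eq_le (hB : 0 < B) (q : ℕ) :
    ((Finset.range T).filter (fun s => s / B = q)).card ≤ B := by
  have : (Finset.range T).filter (fun s => s / B = q) ⊆ Finset.Ico (q * B) (q * B + B) := by
    intro s hs
    rw [Finset.mem_filter] at hs
    rw [Finset.mem_Ico, ← hs.2]
    have h1 := Nat.div_add_mod s B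
    have h2 := Nat.mod_lt s hB
    rw [mul_comm B] at h1
    omega
  simpa using Finset.card_le_card this

lemma sum_blockDrift_le (hB : 0 < B) (hv0 : ∀ u, 0 ≤ v u) :
    ∑ s ∈ Finset.range T, blockDrift v T B (s / B) ≤ B * ∑ u ∈ Finset.range T, v u := by
  simp only [blockDrift, Finset.sum_filter]
  rw [Finset.sum_comm, Finset.mul_sum]
  refine Finset.sum_le_sum fun u _ => ?_
  rw [← Finset.sum_filter, Finset.sum_const, nsmul_eq_mul]
  refine mul_le_mul_of_nonneg_right ?_ (hv0 u)
  simp only [eq_comm (a := u / B)]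
  exact_mod_cast card_filter_div_eq_le hB (u / B)

lemma radius_nonneg (hL : L = Real.log (2 / δ)) (hL0 : 0 ≤ L) (S : Finset ℕ) (i : Fin K) :
    0 ≤ radius δ x S i := by
  by_cases h : S.card ≤ 1
  · rw [radius, if_pos h]
    norm_num
  · have h2 : 2 ≤ S.card := by omega
    have h0 : (0 : ℝ) < S.card := by
      exact_mod_cast (by omega : 0 < S.card)
    have := le_card_mul_radius (x := x) (i := i) h2 hL hL0
    by_contra hneg
    have h3 : S.card * radius δ x S i < 0 := mul_neg_of_pos_of_neg h0 (not_le.1 hneg)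
    have : 0 ≤ 2 * √(L * sumSqDev (fun s => x s i) S) + 7 / 3 * L := by positivity
    linarith

/-- In a good block the empirical mean is within `radius` of the average of the means at the steps
it is built from, hence, up to the drift, of the current mean. -/
lemma IsGoodBlock.deviation_empMean_le {t : ℕ} (hg : IsGoodBlock L T B x μ a (t / B))
    (hL : L = Real.log (2 / δ)) (hL1 : 15 / 8 ≤ L)
    (hx : ∀ t < T, ∀ i, x t i ∈ Set.Icc (0 : ℝ) 1)
    (hv0 : ∀ u, 0 ≤ v u) (hv : ∀ s i, |μ (s + 1) i - μ s i| ≤ v (s + 1)) (ht : t < T) (i : Fin K)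
    (hn : 2 ≤ (plays B a t i).card) {σ : ℝ} (hσ : σ = 1 ∨ σ = -1) :
    σ * (empMean x (plays B a t i) i - μ t i) ≤
      radius δ x (plays B a t i) i + blockDrift v T B (t / B) := by
  rw [plays_eq_blockPlays] at hn ⊢
  have hn0 : (0 : ℝ) < (blockPlays B a (t / B) t i).card := by
    exact_mod_cast (by omega : 0 < (blockPlays B a (t / B) t i).card)
  have h1 := (hg.deviation_le hL1 hx ht.le i hσ).trans
    (le_card_mul_radius (x := x) (i := i) hn hL (by linarith))
  have h2 : σ * ∑ s ∈ blockPlays B a (t / B) t i, (μ s i - μ t i) ≤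
      (blockPlays B a (t / B) t i).card * blockDrift v T B (t / B) := by
    rw [Finset.mul_sum]
    refine (Finset.sum_le_sum (g := fun _ => blockDrift v T B (t / B)) fun s hs => ?_).trans
      (le_of_eq (by simp))
    rw [mem_blockPlays] at hs
    have h3 := abs_sub_le_blockDrift hv0 hv ht (hs.1.trans ht) rfl hs.2.1 i
    rcases hσ with rfl | rfl
    · linarith [le_abs_self (μ s i - μ t i)]
    · linarith [neg_abs_le (μ s i - μ t i)]
  rw [empMean_eq]
  set n : ℝ := ((blockPlays B a (t / B) t i).card : ℝ) with hn_def
  have e : n * (σ * ((∑ s ∈ blockPlays B a (t / B) t i, x s i) / n - μ t i)) =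
      σ * ∑ s ∈ blockPlays B a (t / B) t i, (x s i - μ s i)
      + σ * ∑ s ∈ blockPlays B a (t / B) t i, (μ s i - μ t i) := by
    simp only [Finset.sum_sub_distrib, Finset.sum_const, nsmul_eq_mul]
    rw [← hn_def]
    field_simp
    ring
  refine le_of_mul_le_mul_left ?_ hn0
  rw [e]
  linarith

lemma IsGoodBlock.index_le {t : ℕ} (hg : IsGoodBlock L T B x μ a (t / B))
    (hL : L = Real.log (2 / δ)) (hL1 : 15 / 8 ≤ L)
    (hx : ∀ t < T, ∀ i, x t i ∈ Set.Icc (0 : ℝ) 1) (hμ : ∀ t < T, ∀ i, μ t i ∈ Set.Icc (0 : ℝ) 1)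
    (hv0 : ∀ u, 0 ≤ v u) (hv : ∀ s i, |μ (s + 1) i - μ s i| ≤ v (s + 1)) (ht : t < T)
    (i : Fin K) : index B δ x a t i ≤ μ t i + blockDrift v T B (t / B) := by
  rw [index]
  by_cases hn : (plays B a t i).card ≤ 1
  · have h1 : empMean x (plays B a t i) i ≤ 1 := (empMean_mem_Icc fun s hs => hx s (by
      rw [plays_eq_blockPlays, mem_blockPlays] at hs
      omega) i).2
    rw [radius, if_pos hn]
    linarith [(hμ t ht i).1, blockDrift_nonneg (T := T) (B := B) hv0 (t / B)]
  · have := hg.deviation_empMean_le hL hL1 hx hv0 hv ht i (by omega) (Or.inl rfl)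
    linarith

lemma IsGoodBlock.le_index {t : ℕ} (hg : IsGoodBlock L T B x μ a (t / B))
    (hL : L = Real.log (2 / δ)) (hL1 : 15 / 8 ≤ L)
    (hx : ∀ t < T, ∀ i, x t i ∈ Set.Icc (0 : ℝ) 1) (hμ : ∀ t < T, ∀ i, μ t i ∈ Set.Icc (0 : ℝ) 1)
    (hv0 : ∀ u, 0 ≤ v u) (hv : ∀ s i, |μ (s + 1) i - μ s i| ≤ v (s + 1)) (ht : t < T)
    (i : Fin K) : μ t i - blockDrift v T B (t / B) - 2 * radius δ x (plays B a t i) i ≤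
      index B δ x a t i := by
  rw [index]
  by_cases hn : (plays B a t i).card ≤ 1
  · have h1 : 0 ≤ empMean x (plays B a t i) i := (empMean_mem_Icc fun s hs => hx s (by
      rw [plays_eq_blockPlays, mem_blockPlays] at hs
      omega) i).1
    rw [radius, if_pos hn]
    linarith [(hμ t ht i).2, blockDrift_nonneg (T := T) (B := B) hv0 (t / B)]
  · have := hg.deviation_empMean_le hL hL1 hx hv0 hv ht i (by omega) (Or.inr rfl)
    linarith

/-- The radii of the played arm, summed over the plays of one arm in one block. -/
lemma sum_radius_le (hL : L = Real.log (2 / δ)) (hL0 : 0 ≤ L) (hT : Real.log T ≤ L) (k : ℕ)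
    (i : Fin K) (c : ℝ) :
    ∑ s ∈ blockPlays B a k T i, radius δ x (blockPlays B a k s i) i ≤
      2 + (1 + L) * (2 * √(L * ∑ s ∈ blockPlays B a k T i, (x s i - c) ^ 2) + 7 / 3 * L) := by
  set φ := 2 * √(L * ∑ s ∈ blockPlays B a k T i, (x s i - c) ^ 2) + 7 / 3 * L with hφ
  have hφ0 : 0 ≤ φ := by positivity
  -- the `n`-th radius, `n ≥ 2`, is at most `φ / (n - 1)`
  have key (t : ℕ) (ht : t ≤ T) :
      ∑ s ∈ blockPlays B a k t i, radius δ x (blockPlays B a k s i) i ≤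
        (min (blockPlays B a k t i).card 2 : ℕ) +
          φ * (harmonic ((blockPlays B a k t i).card - 2) : ℝ) := by
    induction t with
    | zero => simp
    | succ t ih =>
      have ih := ih (by omega)
      by_cases hp : t / B = k ∧ a t = i
      · have hn := notMem_blockPlays_self B a k t i
        rw [blockPlays_succ_of_play hp, Finset.sum_insert hn, Finset.card_insert_of_notMem hn]
        rcases Nat.lt_or_ge (blockPlays B a k t i).card 2 with h2 | h2
        · rw [radius, if_pos (by omega)]
          interval_cases (blockPlays B a k t i).card
          · norm_num at ih ⊢
            linarith
          · norm_num at ih ⊢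
            linarith
        · have hr := radius_le (x := x) (i := i) h2 hL hL0
            (Q := ∑ s ∈ blockPlays B a k T i, (x s i - c) ^ 2) (by
              refine (sumSqDev_le _ _ c).trans ?_
              refine Finset.sum_le_sum_of_subset_of_nonneg (fun s hs => ?_)
                fun _ _ _ => sq_nonneg _
              rw [mem_blockPlays] at hs ⊢
              exact ⟨by omega, hs.2⟩)
          rw [← hφ] at hr
          obtain ⟨m, hm⟩ := Nat.exists_eq_add_of_le' h2
          rw [hm] at hr ih ⊢
          rw [show m + 2 + 1 - 2 = m + 1 by omega, harmonic_succ,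
            show min (m + 2 + 1) 2 = 2 by omega]
          rw [show m + 2 - 2 = m by omega, show min (m + 2) 2 = 2 by omega] at ih
          push_cast at hr ih ⊢
          rw [show (m : ℝ) + 2 - 1 = m + 1 by ring] at hr
          linarith
      · rw [blockPlays_succ_of_not_play hp]
        exact ih
  refine (key T le_rfl).trans ?_
  have hcard := card_blockPlays_le B a k T i
  set n := (blockPlays B a k T i).card
  have h1 : ((min n 2 : ℕ) : ℝ) ≤ 2 := by exact_mod_cast min_le_right n 2
  have h2 : (harmonic (n - 2) : ℝ) ≤ 1 + L := by
    refine (harmonic_le_one_add_log _).trans ?_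
    rcases Nat.eq_zero_or_pos (n - 2) with h | h
    · rw [h]
      simpa using hL0
    · have : Real.log ((n - 2 : ℕ) : ℝ) ≤ Real.log T :=
        Real.log_le_log (by exact_mod_cast h) (by exact_mod_cast (by omega : n - 2 ≤ T))
      linarith
  nlinarith

/-- Splitting the steps according to the block they lie in and the arm they play. -/
lemma sum_range_eq_sum_blockPlays (f : ℕ → ℝ) :
    ∑ p ∈ Finset.range (T / B + 1) ×ˢ (Finset.univ : Finset (Fin K)),
      ∑ s ∈ blockPlays B a p.1 T p.2, f s = ∑ s ∈ Finset.range T, f s := by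
  rw [← Finset.sum_fiberwise_of_maps_to (s := Finset.range T)
    (t := Finset.range (T / B + 1) ×ˢ (Finset.univ : Finset (Fin K)))
    (g := fun s => (s / B, a s)) (fun s hs => ?_)]
  · refine Finset.sum_congr rfl fun p _ => Finset.sum_congr ?_ fun _ _ => rfl
    ext s
    simp [blockPlays, Prod.ext_iff]
  · rw [Finset.mem_range] at hs
    simp only [Finset.mem_product, Finset.mem_range, Finset.mem_univ, and_true]
    exact Nat.lt_succ_of_le (Nat.div_le_div_right hs.le)

lemma sum_plays_radius_le (hB : 0 < B) (hL : L = Real.log (2 / δ)) (hL0 : 0 ≤ L)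
    (hT : Real.log T ≤ L) (hμ : ∀ t < T, ∀ i, μ t i ∈ Set.Icc (0 : ℝ) 1)
    (hv0 : ∀ u, 0 ≤ v u) (hv : ∀ s i, |μ (s + 1) i - μ s i| ≤ v (s + 1)) :
    ∑ t ∈ Finset.range T, radius δ x (plays B a t (a t)) (a t) ≤
      K * ((T / B : ℕ) + 1) * (2 + (1 + L) * (7 / 3 * L)) +
        (1 + L) * (2 * √(L * (K * ((T / B : ℕ) + 1) *
          (2 * ∑ t ∈ Finset.range T, ∑ i, (x t i - μ t i) ^ 2 +
            2 * (B * ∑ u ∈ Finset.range T, v u))))) := by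
  classical
  set I := Finset.range (T / B + 1) ×ˢ (Finset.univ : Finset (Fin K)) with hI
  have hcard : (I.card : ℝ) = K * ((T / B : ℕ) + 1) := by
    rw [hI, Finset.card_product]
    simp [mul_comm]
  -- within a block, the losses are compared with the means at its first step
  let q (p : ℕ × Fin K) : ℝ := ∑ s ∈ blockPlays B a p.1 T p.2, (x s p.2 - μ (B * p.1) p.2) ^ 2
  have hq (p : ℕ × Fin K) : 0 ≤ q p := Finset.sum_nonneg fun _ _ => sq_nonneg _
  have h1 : ∑ t ∈ Finset.range T, radius δ x (plays B a t (a t)) (a t)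
      = ∑ p ∈ I, ∑ s ∈ blockPlays B a p.1 T p.2, radius δ x (blockPlays B a p.1 s p.2) p.2 := by
    rw [← sum_range_eq_sum_blockPlays (B := B) (a := a)]
    refine Finset.sum_congr rfl fun p _ => Finset.sum_congr rfl fun s hs => ?_
    rw [mem_blockPlays] at hs
    rw [plays_eq_blockPlays, hs.2.1, hs.2.2]
  have h2 : ∑ p ∈ I, q p ≤ 2 * ∑ t ∈ Finset.range T, ∑ i, (x t i - μ t i) ^ 2 +
      2 * (B * ∑ u ∈ Finset.range T, v u) := by
    have e : ∑ p ∈ I, q p =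
        ∑ s ∈ Finset.range T, (x s (a s) - μ (B * (s / B)) (a s)) ^ 2 := by
      rw [← sum_range_eq_sum_blockPlays (B := B) (a := a)]
      refine Finset.sum_congr rfl fun p _ => Finset.sum_congr rfl fun s hs => ?_
      rw [mem_blockPlays] at hs
      rw [hs.2.1, hs.2.2]
    rw [e]
    have h3 := sum_blockDrift_le (T := T) hB hv0
    have h4 : ∑ s ∈ Finset.range T, (x s (a s) - μ (B * (s / B)) (a s)) ^ 2 ≤
        ∑ s ∈ Finset.range T, (2 * ∑ i, (x s i - μ s i) ^ 2 + 2 * blockDrift v T B (s / B)) := by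
      refine Finset.sum_le_sum fun s hs => ?_
      rw [Finset.mem_range] at hs
      have hb : B * (s / B) < T := (Nat.mul_div_le s B).trans_lt hs
      have h5 := abs_sub_le_blockDrift hv0 hv hb hs (Nat.mul_div_cancel_left _ hB) rfl (a s)
      have h6 : (x s (a s) - μ s (a s)) ^ 2 ≤ ∑ i, (x s i - μ s i) ^ 2 :=
        Finset.single_le_sum (f := fun i => (x s i - μ s i) ^ 2) (fun _ _ => sq_nonneg _)
          (Finset.mem_univ (a s))
      have h7 : |μ s (a s) - μ (B * (s / B)) (a s)| ≤ 1 := by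
        rw [abs_le]
        constructor <;> linarith [(hμ s hs (a s)).1, (hμ s hs (a s)).2, (hμ _ hb (a s)).1,
          (hμ _ hb (a s)).2]
      -- a drift of size at most one is not smaller than its square
      have h8 : (μ s (a s) - μ (B * (s / B)) (a s)) ^ 2 ≤ blockDrift v T B (s / B) := by
        rw [← sq_abs]
        nlinarith [abs_nonneg (μ s (a s) - μ (B * (s / B)) (a s))]
      nlinarith [sq_nonneg ((x s (a s) - μ s (a s)) - (μ s (a s) - μ (B * (s / B)) (a s)))]
    rw [Finset.sum_add_distrib, ← Finset.mul_sum, ← Finset.mul_sum] at h4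
    linarith
  have h3 : ∑ p ∈ I, √(L * q p) ≤ √(L * (I.card * ∑ p ∈ I, q p)) := by
    refine Real.le_sqrt_of_sq_le ((sq_sum_le_card_mul_sum_sq).trans (le_of_eq ?_))
    rw [Finset.sum_congr rfl fun p _ => Real.sq_sqrt (mul_nonneg hL0 (hq p)), ← Finset.mul_sum]
    ring
  have h4 : √(L * (I.card * ∑ p ∈ I, q p)) ≤ √(L * (K * ((T / B : ℕ) + 1) *
      (2 * ∑ t ∈ Finset.range T, ∑ i, (x t i - μ t i) ^ 2 +
        2 * (B * ∑ u ∈ Finset.range T, v u)))) := by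
    rw [← hcard]
    exact Real.sqrt_le_sqrt (by gcongr)
  rw [h1]
  refine (Finset.sum_le_sum fun p _ =>
    sum_radius_le hL hL0 hT p.1 p.2 (μ (B * p.1) p.2)).trans ?_
  have e : ∑ p ∈ I, (2 + (1 + L) * (2 * √(L * q p) + 7 / 3 * L)) =
      I.card * (2 + (1 + L) * (7 / 3 * L)) + (1 + L) * (2 * ∑ p ∈ I, √(L * q p)) := by
    rw [Finset.mul_sum, Finset.mul_sum, ← nsmul_eq_mul, ← Finset.sum_const,
      ← Finset.sum_add_distrib]
    exact Finset.sum_congr rfl fun p _ => by ring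
  rw [e, hcard]
  have := h3.trans h4
  gcongr

open Classical in
/-- Regret along one path: one unit for each step in a block where the confidence intervals fail,
twice the drift of the block, and twice the radius of the played arm. -/
lemma sum_regret_le (hB : 0 < B) (hL : L = Real.log (2 / δ)) (hL1 : 15 / 8 ≤ L)
    (hT : Real.log T ≤ L)
    (hx : ∀ t < T, ∀ i, x t i ∈ Set.Icc (0 : ℝ) 1) (hμ : ∀ t < T, ∀ i, μ t i ∈ Set.Icc (0 : ℝ) 1)
    (hv0 : ∀ u, 0 ≤ v u) (hv : ∀ s i, |μ (s + 1) i - μ s i| ≤ v (s + 1))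
    (hrun : ∀ t < T, ∀ i, index B δ x a t (a t) ≤ index B δ x a t i) :
    ∑ t ∈ Finset.range T, (μ t (a t) - ⨅ i, μ t i) ≤
      ∑ t ∈ Finset.range T, (if IsGoodBlock L T B x μ a (t / B) then 0 else 1) +
      2 * (B * ∑ u ∈ Finset.range T, v u) +
      2 * (K * ((T / B : ℕ) + 1) * (2 + (1 + L) * (7 / 3 * L)) +
        (1 + L) * (2 * √(L * (K * ((T / B : ℕ) + 1) *
          (2 * ∑ t ∈ Finset.range T, ∑ i, (x t i - μ t i) ^ 2 +
            2 * (B * ∑ u ∈ Finset.range T, v u)))))) := by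
  have hL0 : 0 ≤ L := by linarith
  have h1 : ∑ t ∈ Finset.range T, (μ t (a t) - ⨅ i, μ t i) ≤
      ∑ t ∈ Finset.range T, ((if IsGoodBlock L T B x μ a (t / B) then 0 else 1) +
        2 * blockDrift v T B (t / B) + 2 * radius δ x (plays B a t (a t)) (a t)) := by
    refine Finset.sum_le_sum fun t ht => ?_
    rw [Finset.mem_range] at ht
    have hne : Nonempty (Fin K) := ⟨a t⟩
    have hD := blockDrift_nonneg (T := T) (B := B) hv0 (t / B)
    have hr := radius_nonneg (x := x) hL hL0 (plays B a t (a t)) (a t)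
    split_ifs with hg
    · have : μ t (a t) - (2 * blockDrift v T B (t / B) +
          2 * radius δ x (plays B a t (a t)) (a t)) ≤ ⨅ i, μ t i := by
        refine le_ciInf fun i => ?_
        have h2 := hg.index_le hL hL1 hx hμ hv0 hv ht i
        have h3 := hg.le_index hL hL1 hx hμ hv0 hv ht (a t)
        linarith [hrun t ht i]
      linarith
    · have : 0 ≤ ⨅ i, μ t i := le_ciInf fun i => (hμ t ht i).1
      linarith [(hμ t ht (a t)).2]
  rw [Finset.sum_add_distrib, Finset.sum_add_distrib, ← Finset.mul_sum, ← Finset.mul_sum] at h1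
  have h2 := sum_blockDrift_le (T := T) hB hv0
  have h3 := sum_plays_radius_le (x := x) (a := a) hB hL hL0 hT hμ hv0 hv
  linarith

end Path

end RerunUCBV

namespace RerunUCBV

/-! ### The expected regret -/

/-- Jensen's inequality for the square root. -/
lemma integral_sqrt_le {Ω : Type*} {mΩ : MeasurableSpace Ω} {P : Measure Ω}
    [IsProbabilityMeasure P] {f : Ω → ℝ} (hf : Integrable f P) (hf0 : ∀ ω, 0 ≤ f ω) :
    Integrable (fun ω => √(f ω)) P ∧ ∫ ω, √(f ω) ∂P ≤ √(∫ ω, f ω ∂P) := by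
  have h1 : Integrable (fun ω => √(f ω)) P := by
    refine Integrable.mono' (hf.add (integrable_const (1 : ℝ)))
      (Real.continuous_sqrt.comp_aestronglyMeasurable hf.aestronglyMeasurable)
      (Filter.Eventually.of_forall fun ω => ?_)
    rw [Real.norm_of_nonneg (Real.sqrt_nonneg _)]
    have := Real.sq_sqrt (hf0 ω)
    simp only [Pi.add_apply]
    nlinarith [sq_nonneg (√(f ω) - 1), Real.sqrt_nonneg (f ω)]
  exact ⟨h1, Real.strictConcaveOn_sqrt.concaveOn.le_map_integral
    Real.continuous_sqrt.continuousOn isClosed_Ici (Filter.Eventually.of_forall hf0) hf h1⟩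

variable {K : ℕ} {Ω : Type*} {mΩ : MeasurableSpace Ω}

/-- The drift from the step before `t` to step `t`. -/
noncomputable def drift (P : Measure Ω) (ℓ : ℕ → Ω → Fin K → ℝ) (t : ℕ) : ℝ :=
  ‖mean P ℓ t - prevMean P ℓ t‖

lemma totalDrift_eq (P : Measure Ω) (ℓ : ℕ → Ω → Fin K → ℝ) (T : ℕ) :
    totalDrift P ℓ T = ∑ t ∈ Finset.range T, drift P ℓ t := rfl

lemma drift_nonneg (P : Measure Ω) (ℓ : ℕ → Ω → Fin K → ℝ) (t : ℕ) : 0 ≤ drift P ℓ t :=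
  norm_nonneg _

lemma abs_mean_succ_sub_le (P : Measure Ω) (ℓ : ℕ → Ω → Fin K → ℝ) (t : ℕ) (i : Fin K) :
    |mean P ℓ (t + 1) i - mean P ℓ t i| ≤ drift P ℓ (t + 1) :=
  norm_le_pi_norm (mean P ℓ (t + 1) - mean P ℓ t) i

lemma mean_le_totalDrift (P : Measure Ω) (ℓ : ℕ → Ω → Fin K → ℝ) {t T : ℕ} (ht : t < T)
    (i : Fin K) : mean P ℓ t i ≤ totalDrift P ℓ T := by
  have h1 : mean P ℓ t i ≤ totalDrift P ℓ (t + 1) := by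
    clear ht
    induction t with
    | zero =>
      have h2 : |mean P ℓ 0 i| ≤ drift P ℓ 0 := by
        have := norm_le_pi_norm (mean P ℓ 0 - prevMean P ℓ 0) i
        simpa [prevMean, drift] using this
      rw [totalDrift_eq, Finset.sum_range_one]
      exact (le_abs_self _).trans h2
    | succ t ih =>
      rw [totalDrift_eq, Finset.sum_range_succ, ← totalDrift_eq]
      linarith [(le_abs_self _).trans (abs_mean_succ_sub_le P ℓ t i)]
  refine h1.trans ?_
  rw [totalDrift_eq, totalDrift_eq]
  exact Finset.sum_le_sum_of_subset_of_nonneg (Finset.range_subset_range.2 ht)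
    fun u _ _ => drift_nonneg P ℓ u

lemma totalVariance_nonneg (P : Measure Ω) (ℓ : ℕ → Ω → Fin K → ℝ) (T : ℕ) :
    0 ≤ totalVariance P ℓ T :=
  Finset.sum_nonneg fun _ _ => integral_nonneg fun _ => Finset.sum_nonneg fun _ _ => sq_nonneg _

/-- The event that a log-wealth process of block `k` reaches `L`. -/
def badEvent (P : Measure Ω) (ℓ : ℕ → Ω → Fin K → ℝ) (a : ℕ → Ω → Fin K) (L : ℝ) (T B k : ℕ) :
    Set Ω :=
  ⋃ p ∈ (Finset.univ : Finset (Fin K)) ×ˢ Finset.range (Nat.log 2 T + 1) ×ˢ ({1, -1} : Finset ℝ),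
    {ω | ∃ t ≤ T, L ≤ logWealth B (fun s => ℓ s ω) (mean P ℓ) (fun s => a s ω) k p.1
      (1 / (1 + 2 ^ p.2.1)) p.2.2 t}

lemma isGoodBlock_of_notMem_badEvent {P : Measure Ω} {ℓ : ℕ → Ω → Fin K → ℝ}
    {a : ℕ → Ω → Fin K} {L : ℝ} {T B k : ℕ} {ω : Ω} (h : ω ∉ badEvent P ℓ a L T B k) :
    IsGoodBlock L T B (fun s => ℓ s ω) (mean P ℓ) (fun s => a s ω) k := by
  intro i j hj σ hσ t ht
  by_contra hlt
  refine h (Set.mem_biUnion (x := (i, j, σ)) ?_ ⟨t, ht, not_lt.1 hlt⟩)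
  simpa using And.intro (Finset.mem_range.1 hj) hσ

namespace IsEnvironment

variable {T B : ℕ} {P : Measure Ω} {ℱ : Filtration ℕ mΩ} {ℓ : ℕ → Ω → Fin K → ℝ}
  {a : ℕ → Ω → Fin K}

lemma measurableSet_badEvent (h : IsEnvironment T P ℱ ℓ a) (L : ℝ) (B k : ℕ) :
    MeasurableSet (badEvent P ℓ a L T B k) := by
  refine Finset.measurableSet_biUnion _ fun p _ => ?_
  have : {ω | ∃ t ≤ T, L ≤ logWealth B (fun s => ℓ s ω) (mean P ℓ) (fun s => a s ω) k p.1
      (1 / (1 + 2 ^ p.2.1)) p.2.2 t} = ⋃ t ∈ Finset.range (T + 1),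
      {ω | L ≤ logWealth B (fun s => ℓ s ω) (mean P ℓ) (fun s => a s ω) k p.1
        (1 / (1 + 2 ^ p.2.1)) p.2.2 t} := by
    ext ω
    simp
  rw [this]
  refine Finset.measurableSet_biUnion _ fun t ht => ?_
  have ht' : t ≤ T := Nat.lt_succ_iff.1 (Finset.mem_range.1 ht)
  exact ℱ.le t _ (h.measurable_logWealth ht' B k p.1 _ p.2.2 measurableSet_Ici)

variable [IsProbabilityMeasure P]

lemma measureReal_badEvent_le (h : IsEnvironment T P ℱ ℓ a) (L : ℝ) (B k : ℕ) :
    P.real (badEvent P ℓ a L T B k) ≤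
      K * ((Nat.log 2 T + 1 : ℕ) * 2) * Real.exp (-L) := by
  refine (measureReal_biUnion_finset_le _ _).trans ?_
  refine (Finset.sum_le_sum (g := fun _ => Real.exp (-L)) fun p hp => ?_).trans (le_of_eq ?_)
  · refine h.measureReal_exists_le_logWealth B k p.1 (by positivity) ?_ ?_ L
    · rw [div_lt_one (by positivity)]
      linarith [show (0 : ℝ) < 2 ^ p.2.1 by positivity]
    · simp only [Finset.mem_product, Finset.mem_insert, Finset.mem_singleton] at hp
      exact hp.2.2
  · have h2 : ({1, -1} : Finset ℝ).card = 2 := Finset.card_pair (by norm_num)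
    rw [Finset.sum_const, Finset.card_product, Finset.card_product, h2, Finset.card_univ,
      Fintype.card_fin, Finset.card_range, nsmul_eq_mul]
    push_cast
    ring

lemma integrable_sum_sq (h : IsEnvironment T P ℱ ℓ a) {t : ℕ} (ht : t < T) :
    Integrable (fun ω => ∑ i, (ℓ t ω i - mean P ℓ t i) ^ 2) P := by
  refine integrable_finsetSum _ fun i _ => ?_
  refine Integrable.of_bound
    (((h.measurable_loss_apply ht i).sub_const _).pow_const 2).aestronglyMeasurable 1
    (Filter.Eventually.of_forall fun ω => ?_)
  have hx := h.loss_mem t ht ω i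
  have hm := h.mean_mem ht i
  rw [Real.norm_of_nonneg (sq_nonneg _), sq_le_one_iff_abs_le_one, abs_le]
  constructor <;> linarith [hx.1, hx.2, hm.1, hm.2]

lemma totalDrift_le (h : IsEnvironment T P ℱ ℓ a) : totalDrift P ℓ T ≤ T := by
  have : ∀ t ∈ Finset.range T, drift P ℓ t ≤ 1 := by
    intro t ht
    rw [Finset.mem_range] at ht
    refine (pi_norm_le_iff_of_nonneg zero_le_one).2 fun i => ?_
    have hm := h.mean_mem ht i
    have hp : prevMean P ℓ t i ∈ Set.Icc (0 : ℝ) 1 := by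
      cases t with
      | zero => simp [prevMean]
      | succ t => exact h.mean_mem (by omega) i
    rw [Pi.sub_apply, Real.norm_eq_abs, abs_le]
    constructor <;> linarith [hm.1, hm.2, hp.1, hp.2]
  simpa [totalDrift_eq] using Finset.sum_le_sum this

/-- As the means start from `0`, they never exceed the total drift. -/
lemma expectedRegret_le_mul_totalDrift (h : IsEnvironment T P ℱ ℓ a) :
    expectedRegret P ℓ T a ≤ T * totalDrift P ℓ T := by
  have hpath (ω : Ω) : ∑ t ∈ Finset.range T, (mean P ℓ t (a t ω) - ⨅ i, mean P ℓ t i) ≤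
      T * totalDrift P ℓ T := by
    have : ∀ t ∈ Finset.range T, (mean P ℓ t (a t ω) - ⨅ i, mean P ℓ t i) ≤
        totalDrift P ℓ T := by
      intro t ht
      rw [Finset.mem_range] at ht
      have hne : Nonempty (Fin K) := ⟨a t ω⟩
      have h1 : 0 ≤ ⨅ i, mean P ℓ t i := le_ciInf fun i => (h.mean_mem ht i).1
      linarith [mean_le_totalDrift P ℓ ht (a t ω)]
    simpa using Finset.sum_le_sum this
  have h0 (ω : Ω) : 0 ≤ ∑ t ∈ Finset.range T, (mean P ℓ t (a t ω) - ⨅ i, mean P ℓ t i) :=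
    Finset.sum_nonneg fun t _ => sub_nonneg.2 (ciInf_le (Set.finite_range _).bddBelow _)
  have := integral_mono_of_nonneg (μ := P) (Filter.Eventually.of_forall h0)
    (integrable_const (T * totalDrift P ℓ T)) (Filter.Eventually.of_forall hpath)
  simpa [expectedRegret] using this

/-- The regret bound for an arbitrary block length. -/
lemma expectedRegret_le {L δ : ℝ} (h : IsEnvironment T P ℱ ℓ a) (hB : 0 < B)
    (hL : L = Real.log (2 / δ)) (hL1 : 15 / 8 ≤ L) (hT : Real.log T ≤ L)
    (hrun : ∀ ω, ∀ t < T, ∀ i, index B δ (fun t => ℓ t ω) (fun t => a t ω) t (a t ω) ≤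
      index B δ (fun t => ℓ t ω) (fun t => a t ω) t i) :
    expectedRegret P ℓ T a ≤
      T * (K * ((Nat.log 2 T + 1 : ℕ) * 2) * Real.exp (-L)) +
      2 * (B * totalDrift P ℓ T) +
      2 * (K * ((T / B : ℕ) + 1) * (2 + (1 + L) * (7 / 3 * L)) +
        (1 + L) * (2 * √(L * (K * ((T / B : ℕ) + 1) *
          (2 * totalVariance P ℓ T + 2 * (B * totalDrift P ℓ T)))))) := by
  classical
  have hL0 : 0 ≤ L := by linarith
  set V := totalDrift P ℓ T with hV
  have hV0 : 0 ≤ V := Finset.sum_nonneg fun u _ => drift_nonneg P ℓ u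
  set N : ℝ := K * ((T / B : ℕ) + 1) with hN
  have hN0 : 0 ≤ N := by positivity
  let Y (ω : Ω) : ℝ := ∑ t ∈ Finset.range T, ∑ i, (ℓ t ω i - mean P ℓ t i) ^ 2
  have hY0 (ω : Ω) : 0 ≤ Y ω :=
    Finset.sum_nonneg fun _ _ => Finset.sum_nonneg fun _ _ => sq_nonneg _
  have hYi : Integrable Y P := integrable_finsetSum _ fun t ht =>
    h.integrable_sum_sq (Finset.mem_range.1 ht)
  have hYe : ∫ ω, Y ω ∂P = totalVariance P ℓ T :=
    integral_finsetSum _ fun t ht => h.integrable_sum_sq (Finset.mem_range.1 ht)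
  let F (ω : Ω) : ℝ := L * (N * (2 * Y ω + 2 * (B * V)))
  have hFi : Integrable F P :=
    ((((hYi.const_mul 2).add (integrable_const _)).const_mul N).const_mul L)
  have hFe : ∫ ω, F ω ∂P = L * (N * (2 * totalVariance P ℓ T + 2 * (B * V))) := by
    simp only [F]
    rw [integral_const_mul, integral_const_mul,
      integral_add (hYi.const_mul 2) (integrable_const _), integral_const_mul, hYe]
    simp
  obtain ⟨hSi, hSe⟩ := integral_sqrt_le hFi fun ω => by
    have := hY0 ω
    positivity
  rw [hFe] at hSe
  let U (ω : Ω) : ℝ := ∑ t ∈ Finset.range T, (badEvent P ℓ a L T B (t / B)).indicator 1 ω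
  have hIi (t : ℕ) : Integrable ((badEvent P ℓ a L T B (t / B)).indicator (1 : Ω → ℝ)) P :=
    (integrable_const (1 : ℝ)).indicator (h.measurableSet_badEvent L B (t / B))
  have hUi : Integrable U P := integrable_finsetSum _ fun t _ => hIi t
  have hUe : ∫ ω, U ω ∂P ≤ T * (K * ((Nat.log 2 T + 1 : ℕ) * 2) * Real.exp (-L)) := by
    simp only [U]
    rw [integral_finsetSum _ fun t _ => hIi t]
    refine (Finset.sum_le_sum (g := fun _ =>
      K * ((Nat.log 2 T + 1 : ℕ) * 2) * Real.exp (-L)) fun t _ => ?_).trans (le_of_eq (by simp))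
    rw [integral_indicator_one (h.measurableSet_badEvent L B (t / B))]
    exact h.measureReal_badEvent_le L B (t / B)
  let c : ℝ := 2 * (B * V) + 2 * (N * (2 + (1 + L) * (7 / 3 * L)))
  have hpath (ω : Ω) : ∑ t ∈ Finset.range T, (mean P ℓ t (a t ω) - ⨅ i, mean P ℓ t i) ≤
      U ω + (c + 4 * (1 + L) * √(F ω)) := by
    have h1 := sum_regret_le (x := fun t => ℓ t ω) (a := fun t => a t ω) (v := drift P ℓ)
      (μ := mean P ℓ) hB hL hL1 hT (fun t ht i => h.loss_mem t ht ω i)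
      (fun t ht i => h.mean_mem ht i) (drift_nonneg P ℓ) (abs_mean_succ_sub_le P ℓ) (hrun ω)
    rw [← totalDrift_eq, ← hV, ← hN] at h1
    have h2 : ∑ t ∈ Finset.range T, (if IsGoodBlock L T B (fun t => ℓ t ω) (mean P ℓ)
        (fun t => a t ω) (t / B) then (0 : ℝ) else 1) ≤ U ω := by
      refine Finset.sum_le_sum fun t _ => ?_
      by_cases hb : ω ∈ badEvent P ℓ a L T B (t / B)
      · rw [Set.indicator_of_mem hb]
        split_ifs <;> simp
      · rw [if_pos (isGoodBlock_of_notMem_badEvent hb), Set.indicator_of_notMem hb]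
    refine (h1.trans (add_le_add (add_le_add h2 le_rfl) le_rfl)).trans (le_of_eq ?_)
    simp only [c, F, Y]
    ring
  have h0 (ω : Ω) : 0 ≤ ∑ t ∈ Finset.range T, (mean P ℓ t (a t ω) - ⨅ i, mean P ℓ t i) :=
    Finset.sum_nonneg fun t _ => sub_nonneg.2 (ciInf_le (Set.finite_range _).bddBelow _)
  have hSi' : Integrable (fun ω => c + 4 * (1 + L) * √(F ω)) P :=
    (integrable_const c).add (hSi.const_mul _)
  have hfin := integral_mono_of_nonneg (μ := P) (Filter.Eventually.of_forall h0)
    (hUi.add hSi') (Filter.Eventually.of_forall hpath)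
  have e : ∫ ω, (U + fun ω => c + 4 * (1 + L) * √(F ω)) ω ∂P
      = ∫ ω, U ω ∂P + (c + 4 * (1 + L) * ∫ ω, √(F ω) ∂P) := by
    simp only [Pi.add_apply]
    rw [integral_add hUi hSi', integral_add (integrable_const c) (hSi.const_mul _),
      integral_const_mul]
    simp
  rw [e] at hfin
  have h3 := mul_le_mul_of_nonneg_left hSe (show 0 ≤ 4 * (1 + L) by linarith)
  simp only [expectedRegret]
  refine hfin.trans ((add_le_add hUe (add_le_add le_rfl h3)).trans (le_of_eq ?_))
  simp only [c]
  ring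

end IsEnvironment

/-! ### Tuning the block length -/

/-- The block length before rounding, `x`, balances the drift `x V` of a block against both
statistical errors: the number of blocks is `T / x` up to rounding, the variance term is
`√(K Λ T / x)` and the range term is `K T / x`. -/
lemma exists_blockLength_eq {K T : ℕ} {V Λ : ℝ} (hK : 1 ≤ K) (hT : 1 ≤ T) (hV : 0 < V)
    (hVT : V ≤ T) (hΛ : 0 ≤ Λ) :
    ∃ x g : ℝ, 1 ≤ x ∧ blockLength K T V Λ = ⌈x⌉₊ ∧ g = x * V ∧
      g ≤ ((K : ℝ) ^ 2 * Λ * V * T) ^ ((1 : ℝ) / 3) + √(K * V * T) ∧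
      K * T ≤ x * g ∧ K * Λ * T ≤ x * g ^ 2 := by
  have hK' : (1 : ℝ) ≤ K := by exact_mod_cast hK
  have hT' : (1 : ℝ) ≤ T := by exact_mod_cast hT
  have hTV : 0 < T * V := by positivity
  rw [blockLength, if_neg hV.ne']
  split_ifs with hc
  · set y : ℝ := (K : ℝ) ^ 2 * Λ * T / V ^ 2 with hy
    have hΛ0 : 0 < Λ := by
      rcases hΛ.lt_or_eq with h | rfl
      · exact h
      · norm_num at hc
        linarith
    have hy0 : 0 < y := by positivity
    set x : ℝ := y ^ ((1 : ℝ) / 3) with hx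
    have hx0 : 0 < x := by positivity
    have hx3 : x ^ 3 = y := by
      rw [hx, ← Real.rpow_natCast, ← Real.rpow_mul hy0.le]
      norm_num
    have hyV : y * V ^ 2 = (K : ℝ) ^ 2 * Λ * T := by
      rw [hy]
      field_simp
    have hkey : (K : ℝ) ^ 3 * T ^ 3 * V ≤ ((K : ℝ) ^ 2 * Λ * T) ^ 2 := by
      have := mul_le_mul_of_nonneg_left hc (show 0 ≤ (K : ℝ) ^ 3 * T ^ 2 by positivity)
      linarith
    have hy1 : 1 ≤ y := by
      rw [hy, one_le_div (by positivity)]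
      refine le_of_sq_le_sq ?_ (by positivity)
      refine le_trans ?_ hkey
      have h1 : V ^ 3 ≤ (T : ℝ) ^ 3 := pow_le_pow_left₀ hV.le hVT 3
      have h2 : (1 : ℝ) ≤ (K : ℝ) ^ 3 := one_le_pow₀ hK'
      calc (V ^ 2) ^ 2 = 1 * V ^ 3 * V := by ring
        _ ≤ (K : ℝ) ^ 3 * T ^ 3 * V := by gcongr
    have hx1 : 1 ≤ x := Real.one_le_rpow hy1 (by norm_num)
    refine ⟨x, x * V, hx1, rfl, rfl, ?_, ?_, ?_⟩
    · have : x * V = ((K : ℝ) ^ 2 * Λ * V * T) ^ ((1 : ℝ) / 3) := by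
        have e : (K : ℝ) ^ 2 * Λ * V * T = (x * V) ^ (3 : ℕ) := by
          rw [mul_pow, hx3]
          linear_combination -V * hyV
        rw [e, ← Real.rpow_natCast, ← Real.rpow_mul (by positivity)]
        norm_num
      rw [this]
      linarith [Real.sqrt_nonneg ((K : ℝ) * V * T)]
    · refine le_of_pow_le_pow_left₀ (n := 3) (by norm_num) (by positivity) ?_
      have e : (x * (x * V)) ^ 3 * V = (y * V ^ 2) ^ 2 := by
        rw [← hx3]
        ring
      refine le_of_mul_le_mul_right ?_ hV
      rw [e, hyV]
      linarith
    · have e : x * (x * V) ^ 2 = y * V ^ 2 := by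
        rw [← hx3]
        ring
      rw [e, hyV]
      have : 0 ≤ (K : ℝ) * Λ * T * (K - 1) := by
        have : (0 : ℝ) ≤ K - 1 := by linarith
        positivity
      nlinarith
  · rw [not_le] at hc
    set x : ℝ := √(K * T / V) with hx
    have hx2 : x ^ 2 * V = K * T := by
      rw [hx, Real.sq_sqrt (by positivity)]
      field_simp
    have hx1 : 1 ≤ x := by
      rw [hx, Real.one_le_sqrt, one_le_div hV]
      nlinarith
    refine ⟨x, x * V, hx1, rfl, rfl, ?_, ?_, ?_⟩
    · have : x * V = √(K * V * T) := by
        rw [show (K : ℝ) * V * T = (x * V) ^ 2 by linear_combination -V * hx2,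
          Real.sqrt_sq (by positivity)]
      rw [this]
      have : 0 ≤ ((K : ℝ) ^ 2 * Λ * V * T) ^ ((1 : ℝ) / 3) := by positivity
      linarith
    · linarith
    · refine le_of_sq_le_sq ?_ (by positivity)
      have e : (x * (x * V) ^ 2) ^ 2 = (x ^ 2 * V) ^ 3 * V := by ring
      rw [e, hx2]
      have h1 := mul_le_mul_of_nonneg_left hc.le (show 0 ≤ (K : ℝ) * T ^ 2 by positivity)
      have h2 : (K : ℝ) * T ^ 3 * V ≤ (K : ℝ) ^ 3 * T ^ 3 * V := by
        gcongr
        exact le_self_pow₀ hK' (by norm_num)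
      nlinarith

lemma natLog_two_succ_le {K T : ℕ} (hK : 1 ≤ K) (hT : 1 ≤ T) :
    ((Nat.log 2 T + 1 : ℕ) : ℝ) ≤ 2 * (1 + Real.log (K * T)) := by
  have hK' : (1 : ℝ) ≤ K := by exact_mod_cast hK
  have hT' : (1 : ℝ) ≤ T := by exact_mod_cast hT
  have h1 : ((2 : ℝ) ^ Nat.log 2 T) ≤ T := by exact_mod_cast Nat.pow_log_le_self 2 (by omega)
  have h2 := Real.log_le_log (by positivity) h1
  rw [Real.log_pow] at h2
  have h3 : Real.log T ≤ Real.log (K * T) := Real.log_le_log (by positivity) (by nlinarith)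
  have h4 := Real.log_two_gt_d9
  push_cast
  have h5 : (0 : ℝ) ≤ Nat.log 2 T := by positivity
  nlinarith

/-- The bound of `IsEnvironment.expectedRegret_le` at the tuned block length. -/
lemma tuned_bound_le {L l g V Λ x J e : ℝ} {K T B : ℕ} (hL0 : 0 ≤ L) (hLl : L ≤ l) (hl : 1 ≤ l)
    (hV : 0 < V) (hΛ : 0 ≤ Λ) (hx1 : 1 ≤ x) (hB : B = ⌈x⌉₊) (hxT : x < T) (hg : g = x * V)
    (hK : 1 ≤ K) (h1 : K * T ≤ x * g) (h2 : K * Λ * T ≤ x * g ^ 2)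
    (hJ : J ≤ 2 * l) (he : 2 * (K * T) * e = 1) :
    T * (K * (J * 2) * e) + 2 * (B * V) +
      2 * (K * ((T / B : ℕ) + 1) * (2 + (1 + L) * (7 / 3 * L)) +
        (1 + L) * (2 * √(L * (K * ((T / B : ℕ) + 1) * (2 * Λ + 2 * (B * V)))))) ≤
      100 * l ^ 2 * g := by
  have hK' : (1 : ℝ) ≤ K := by exact_mod_cast hK
  have hx0 : 0 < x := by linarith
  have hT0 : (0 : ℝ) < T := by linarith
  have hg0 : 0 < g := by rw [hg]; positivity
  have hBx : x ≤ B := by rw [hB]; exact Nat.le_ceil x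
  have hBx2 : (B : ℝ) ≤ 2 * x := by
    have := Nat.ceil_lt_add_one hx0.le
    rw [hB]
    linarith
  have hBT : (B : ℝ) ≤ T := by
    rw [hB]
    exact_mod_cast Nat.ceil_le.2 hxT.le
  have hB0 : (0 : ℝ) < B := by linarith
  have hN : ((T / B : ℕ) : ℝ) + 1 ≤ 2 * T / x := by
    have h3 : ((T / B : ℕ) : ℝ) ≤ T / B := Nat.cast_div_le
    have h4 : 1 ≤ (T : ℝ) / B := (one_le_div hB0).2 hBT
    have h5 : (T : ℝ) / B ≤ T / x := by gcongr
    rw [mul_div_assoc]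
    linarith
  set N : ℝ := ((T / B : ℕ) : ℝ) + 1 with hN_def
  have hN0 : 0 ≤ N := by positivity
  have hxN : x * N ≤ 2 * T := by
    rw [le_div_iff₀ hx0] at hN
    linarith
  have hKN : K * N ≤ 2 * g := by
    refine le_of_mul_le_mul_left ?_ hx0
    linarith [mul_le_mul_of_nonneg_left hxN (show (0 : ℝ) ≤ K by positivity)]
  have hKNΛ : K * N * Λ ≤ 2 * g ^ 2 := by
    refine le_of_mul_le_mul_left ?_ hx0
    linarith [mul_le_mul_of_nonneg_left hxN (show 0 ≤ K * Λ by positivity)]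
  have hBV : B * V ≤ 2 * g := by
    rw [hg]
    linarith [mul_le_mul_of_nonneg_right hBx2 hV.le]
  have hKg : 1 ≤ g := by
    have : (T : ℝ) * 1 ≤ T * g := by
      linarith [mul_le_mul_of_nonneg_right hK' hT0.le, mul_le_mul_of_nonneg_right hxT.le hg0.le]
    exact le_of_mul_le_mul_left this hT0
  have hsq : √(L * (K * N * (2 * Λ + 2 * (B * V)))) ≤ 4 * l * g := by
    rw [Real.sqrt_le_left (by positivity)]
    have h3 : K * N * (2 * Λ + 2 * (B * V)) ≤ 12 * g ^ 2 := by
      have : K * N * (B * V) ≤ 2 * g * (2 * g) := by gcongr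
      linarith
    have h4 : L * (K * N * (2 * Λ + 2 * (B * V))) ≤ l * (12 * g ^ 2) := by gcongr
    have h5 : l * g ^ 2 ≤ l ^ 2 * g ^ 2 := by gcongr; nlinarith
    linarith [show (4 * l * g) ^ 2 = 16 * (l ^ 2 * g ^ 2) by ring,
      show l * (12 * g ^ 2) = 12 * (l * g ^ 2) by ring, show 0 ≤ l ^ 2 * g ^ 2 by positivity]
  have hJe : T * (K * (J * 2) * e) ≤ 2 * l := by
    have : T * (K * (J * 2) * e) = J * (2 * (K * T) * e) := by ring
    rw [this, he]
    linarith
  have hll : l ≤ l ^ 2 := by nlinarith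
  have h7 : 2 + (1 + L) * (7 / 3 * L) ≤ 20 / 3 * l ^ 2 := by
    have : (1 + L) * (7 / 3 * L) ≤ (2 * l) * (7 / 3 * l) := by gcongr; linarith
    nlinarith
  have h8 : K * N * (2 + (1 + L) * (7 / 3 * L)) ≤ 2 * g * (20 / 3 * l ^ 2) := by gcongr
  have h9 : (1 + L) * (2 * √(L * (K * N * (2 * Λ + 2 * (B * V))))) ≤
      (2 * l) * (2 * (4 * l * g)) := by gcongr; linarith
  have h10 : 2 * l ≤ 2 * (l ^ 2 * g) := by
    have : l * 1 ≤ l ^ 2 * g := by gcongr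
    linarith
  have h11 : g ≤ l ^ 2 * g := le_mul_of_one_le_left hg0.le (one_le_pow₀ hl)
  rw [show 2 * g * (20 / 3 * l ^ 2) = 40 / 3 * (l ^ 2 * g) by ring] at h8
  rw [show 2 * l * (2 * (4 * l * g)) = 16 * (l ^ 2 * g) by ring] at h9
  rw [mul_assoc 100]
  linarith [show 0 ≤ l ^ 2 * g by positivity]

end RerunUCBV

open RerunUCBV in
theorem mainTheorem1 :
    ∃ C : ℝ, 0 < C ∧ ∃ p : ℕ,
      ∀ (K T : ℕ), 1 ≤ K → 1 ≤ T →
      ∀ (Ω : Type*) [mΩ : MeasurableSpace Ω] (P : Measure Ω) [IsProbabilityMeasure P]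
        -- the information available before each step (past losses, past arms, internal randomness)
        (ℱ : Filtration ℕ mΩ)
        (ℓ : ℕ → Ω → Fin K → ℝ) (a : ℕ → Ω → Fin K),
        -- losses lie in `[0, 1]` and become known, at best, after the step
        (∀ t < T, ∀ ω, ∀ i, ℓ t ω i ∈ Set.Icc (0 : ℝ) 1) →
        (∀ t < T, Measurable[ℱ (t + 1)] (ℓ t)) →
        -- the loss vector of a step is independent of everything that precedes it
        (∀ t < T, Indep (MeasurableSpace.comap (ℓ t) inferInstance) (ℱ t) P) →
        -- the learner does not look ahead, and plays Rerun-UCB-V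
        (∀ t < T, Measurable[ℱ t] (a t)) →
        (∀ ω, RerunUCBV.IsRun T (RerunUCBV.totalDrift P ℓ T) (RerunUCBV.totalVariance P ℓ T)
          (fun t => ℓ t ω) (fun t => a t ω)) →
        RerunUCBV.expectedRegret P ℓ T a ≤
          C * (1 + Real.log ((K : ℝ) * (T : ℝ))) ^ p *
            (((K : ℝ) ^ 2 * RerunUCBV.totalVariance P ℓ T * RerunUCBV.totalDrift P ℓ T * (T : ℝ))
                ^ ((1 : ℝ) / 3) +
              Real.sqrt ((K : ℝ) * RerunUCBV.totalDrift P ℓ T * (T : ℝ))) := by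
  refine ⟨100, by norm_num, 2, ?_⟩
  intro K T hK hT Ω mΩ P _ ℱ ℓ a h1 h2 h3 h4 hrun
  have h : IsEnvironment T P ℱ ℓ a := ⟨h1, h2, h3, h4⟩
  have hK' : (1 : ℝ) ≤ K := by exact_mod_cast hK
  have hT' : (1 : ℝ) ≤ T := by exact_mod_cast hT
  have hKT : (1 : ℝ) ≤ K * T := by nlinarith
  have htriv := h.expectedRegret_le_mul_totalDrift
  have hVT := h.totalDrift_le
  have hΛ := totalVariance_nonneg P ℓ T
  have hV0 : 0 ≤ totalDrift P ℓ T := Finset.sum_nonneg fun u _ => drift_nonneg P ℓ u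
  set V := totalDrift P ℓ T
  set Λ := totalVariance P ℓ T
  set G := ((K : ℝ) ^ 2 * Λ * V * T) ^ ((1 : ℝ) / 3) + √((K : ℝ) * V * T) with hG
  have hG0 : 0 ≤ G := by positivity
  have hl : 1 ≤ 1 + Real.log (K * T) := by linarith [Real.log_nonneg hKT]
  set l := 1 + Real.log ((K : ℝ) * T) with hl_def
  have hl2 : 1 ≤ 100 * l ^ 2 := by nlinarith
  -- the bound `T V` on the regret suffices when `V = 0` or the block covers the whole horizon
  have hsmall (hTG : T * V ≤ G) : expectedRegret P ℓ T a ≤ 100 * l ^ 2 * G := by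
    nlinarith
  rcases hV0.eq_or_lt with hV | hV
  · exact hsmall (by rw [← hV, mul_zero]; exact hG0)
  obtain ⟨x, g, hx1, hB, hg, hgG, h5, h6⟩ := exists_blockLength_eq hK hT hV hVT hΛ
  rcases le_or_gt (T : ℝ) x with hxT | hxT
  · refine hsmall (le_trans ?_ hgG)
    rw [hg]
    gcongr
  refine le_trans ?_ (mul_le_mul_of_nonneg_left hgG (by positivity))
  rcases hK.eq_or_lt with rfl | hK2
  · have : expectedRegret P ℓ T a = 0 := by
      have e (t : ℕ) (i : Fin 1) : mean P ℓ t i - ⨅ i, mean P ℓ t i = 0 := by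
        rw [ciInf_unique, Subsingleton.elim i default, sub_self]
      simp only [expectedRegret, e, Finset.sum_const_zero, integral_zero]
    rw [this, hg]
    positivity
  have hT2 : 2 ≤ T := by
    have : (1 : ℝ) < T := hx1.trans_lt hxT
    exact_mod_cast this
  have hKT4 : (4 : ℝ) ≤ K * T := by exact_mod_cast Nat.mul_le_mul hK2 hT2
  set L := Real.log (2 * (K * T)) with hL_def
  have hL : L = Real.log (2 / (1 / ((K : ℝ) * T))) := by
    rw [hL_def, div_div_eq_mul_div, div_one]
  have hLl : L ≤ l := by
    rw [hL_def, hl_def, Real.log_mul (by norm_num) (by positivity)]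
    linarith [Real.log_two_lt_d9]
  have hL1 : 15 / 8 ≤ L := by
    have h7 : Real.log (2 ^ 3) ≤ L := Real.log_le_log (by norm_num) (by linarith)
    rw [Real.log_pow] at h7
    push_cast at h7
    linarith [Real.log_two_gt_d9]
  have hTL : Real.log T ≤ L := Real.log_le_log (by positivity) (by nlinarith)
  have hB0 : 0 < blockLength K T V Λ := by
    rw [hB]
    exact Nat.ceil_pos.2 (by linarith)
  refine (h.expectedRegret_le hB0 hL hL1 hTL hrun).trans ?_
  refine tuned_bound_le (by linarith) hLl hl hV hΛ hx1 hB hxT hg hK h5 h6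
    (natLog_two_succ_le hK hT) ?_
  rw [Real.exp_neg, hL_def, Real.exp_log (by positivity)]
  exact mul_inv_cancel₀ (by positivity)
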